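/- Let $a\in\mathfrak{sl}(n,\mathbb C)$ be a non-zero diagonal matrix, let $b\in\mathfrak{sl}(n,\mathbb C)$ satisfy $[a,b]=0$, and let $j\ge 1$ be an integer. Let $\mathfrak{sl}(n,\mathbb C)_a^\perp$ be the orthogonal complement, with respect to the trace form, of the centralizer $\{y\in\mathfrak{sl}(n,\mathbb C)\mid [a,y]=0\}$. *Flows.* For a smooth $\mathfrak{sl}(n,\mathbb C)_a^\perp$-valued map $u(x,t)$ on an open neighbourhood $U\subset\mathbb R^2$ of $(0,0)$, let $Q_{b,k}(u)$, $k\ge 0$, denote smooth $\mathfrak{sl}(n,\mathbb C)$-valued maps on $U$ with $Q_{b,0}(u)=b$ and $$(Q_{b,k}(u))_x+[u,Q_{b,k}(u)]=[Q_{b,k+1}(u),a],$$ such that at each point the formal series $\sum_{k\ge0}Q_{b,k}(u)\lambda^{-k}$ is conjugate to $b$ by an invertible formal power series in $\lambda^{-1}$. (If such a family is not unique, it is part of the data.) Then $u$ is a local solution of the $j$-th (ZS–AKNS) flow defined by $b$ on $U$ if $u_t=(Q_{b,j}(u))_x+[u,Q_{b,j}(u)]$. *Trivialization.* A trivialization of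 such a $u$ is a smooth map $E:U\times\mathbb C\to GL(n,\mathbb C)$, entire in $\lambda$, with $$E^{-1}E_x=a\lambda+u,\qquad E^{-1}E_t=b\lambda^j+Q_{b,1}(u)\lambda^{j-1}+\dots+Q_{b,j}(u),\qquad E(0,0,\lambda)=\mathrm{Id}.$$ *Local reduced wave function.* This is, for some $R$, a smooth $GL(n,\mathbb C)$-valued map $\omega(x,t,\lambda)$, $(x,t)\in U$, $|\lambda|>R$, which is holomorphic in $\lambda$, also at $\lambda=\infty$, with $\omega(x,t,\infty)=\mathrm{Id}$, and which satisfies $$E(x,t,\lambda)=\omega(0,0,\lambda)^{-1}e^{a\lambda x+b\lambda^jt}\,\omega(x,t,\lambda).$$ **Proposition.** Let $u$ be a local solution on $U$ of the $j$-th flow defined by $b$, with trivialization $E$ and local reduced wave function $\omega$. Let $\alpha\in\mathbb C$, let $N$ be a complex $n\times n$ matrix with $N^2=0$, and put $$E_1(x,t)=\left.\frac{d}{d\lambda}\right|_{\lambda=\alpha}E(x,t,\lambda)E(x,t,\alpha)^{-1},\qquad \tilde U=\{(x,t)\in U\mid \mathrm{Id}+NE_1(x,t)\text{ is invertible}\},$$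 $$\tilde N(x,t)=E(x,t,\alpha)^{-1}(\mathrm{Id}+NE_1(x,t))^{-1}N\,E(x,t,\alpha)\quad\text{on }\tilde U,\qquad m_{\alpha,1,N}(\lambda)=\mathrm{Id}+\frac1{\lambda-\alpha}N.$$ Then $\tilde U$ is an open neighbourhood of $(0,0)$, and $\tilde u=u-[a,\tilde N]$ is a local solution of the $j$-th flow defined by $b$ on $\tilde U$. It has the trivialization $$\tilde E(x,t,\lambda)=m_{\alpha,1,N}(\lambda)\,E(x,t,\lambda)\,m_{\alpha,1,\tilde N(x,t)}(\lambda)^{-1}\qquad(\lambda\ne\alpha),$$ extended holomorphically over $\lambda=\alpha$, and the local reduced wave function $\tilde\omega(x,t,\lambda)=\omega(x,t,\lambda)\,m_{\alpha,1,\tilde N(x,t)}(\lambda)^{-1}$. -/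

import Mathlib

open scoped ContDiff

/-- A matrix-valued map is smooth (`C^∞` over `ℝ`) on `S`: all its entries are. -/
def MatrixSmoothOn {n : ℕ} {X : Type*} [NormedAddCommGroup X] [NormedSpace ℝ X]
    (f : X → Matrix (Fin n) (Fin n) ℂ) (S : Set X) : Prop :=
  ∀ i k, ContDiffOn ℝ ∞ (fun p => f p i k) S

/-- A matrix-valued map is holomorphic on `S`: all its entries are. -/
def MatrixHolomorphicOn {n : ℕ} (f : ℂ → Matrix (Fin n) (Fin n) ℂ) (S : Set ℂ) : Prop :=
  ∀ i k, DifferentiableOn ℂ (fun z => f z i k) S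

/-- The derivative of a matrix-valued map of one variable (in `ℝ` or `ℂ`), entry by entry. -/
noncomputable def matrixDeriv {n : ℕ} {𝕜 : Type*} [NontriviallyNormedField 𝕜] [NormedSpace 𝕜 ℂ]
    (f : 𝕜 → Matrix (Fin n) (Fin n) ℂ) (x : 𝕜) : Matrix (Fin n) (Fin n) ℂ :=
  Matrix.of fun i k => deriv (fun y => f y i k) x

/-- `y` lies in `sl(n,ℂ)_a^⊥`: it is trace free and orthogonal, for the trace form, to the
centralizer `sl(n,ℂ)_a = {z ∈ sl(n,ℂ) | [a,z] = 0}`. -/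
def InCentralizerPerp {n : ℕ} (a y : Matrix (Fin n) (Fin n) ℂ) : Prop :=
  y.trace = 0 ∧
    ∀ z : Matrix (Fin n) (Fin n) ℂ, z.trace = 0 → ⁅a, z⁆ = 0 → (z * y).trace = 0

/-- `Q k = Q_{b,k}(u)`, `k = 0, 1, 2, …`, on `U`: smooth `sl(n,ℂ)`-valued maps with `Q_{b,0}(u) = b`
and `(Q_{b,k})_x + [u, Q_{b,k}] = [Q_{b,k+1}, a]`, such that at every point the formal series
`∑ Q_{b,k} λ^{-k}` is conjugate to `b` by an invertible formal series in `λ^{-1}`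
(`λ^{-1}` is the variable of the power series). -/
structure IsAKNSFamily {n : ℕ} (a b : Matrix (Fin n) (Fin n) ℂ) (U : Set (ℝ × ℝ))
    (u : ℝ → ℝ → Matrix (Fin n) (Fin n) ℂ)
    (Q : ℕ → ℝ → ℝ → Matrix (Fin n) (Fin n) ℂ) : Prop where
  smooth : ∀ k, MatrixSmoothOn (fun p : ℝ × ℝ => Q k p.1 p.2) U
  trace_eq_zero : ∀ k, ∀ x t, (x, t) ∈ U → (Q k x t).trace = 0
  zero_eq : ∀ x t, (x, t) ∈ U → Q 0 x t = b
  recursion : ∀ k, ∀ x t, (x, t) ∈ U →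
    matrixDeriv (fun y => Q k y t) x + ⁅u x t, Q k x t⁆ = ⁅Q (k + 1) x t, a⁆
  conjugate : ∀ x t, (x, t) ∈ U → ∃ M : (PowerSeries (Matrix (Fin n) (Fin n) ℂ))ˣ,
    PowerSeries.mk (fun k => Q k x t) =
      (M : PowerSeries (Matrix (Fin n) (Fin n) ℂ)) * PowerSeries.C b *
        ((M⁻¹ : (PowerSeries (Matrix (Fin n) (Fin n) ℂ))ˣ) :
          PowerSeries (Matrix (Fin n) (Fin n) ℂ))

/-- `u` is a local solution, on the open neighbourhood `U` of the origin, of the `j`-th flow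
`u_t = (Q_{b,j}(u))_x + [u, Q_{b,j}(u)]` defined by `b`, with `Q k = Q_{b,k}(u)`. -/
structure IsLocalFlowSolution {n : ℕ} (a b : Matrix (Fin n) (Fin n) ℂ) (j : ℕ)
    (U : Set (ℝ × ℝ)) (u : ℝ → ℝ → Matrix (Fin n) (Fin n) ℂ)
    (Q : ℕ → ℝ → ℝ → Matrix (Fin n) (Fin n) ℂ) : Prop where
  isOpen : IsOpen U
  zero_mem : ((0 : ℝ), (0 : ℝ)) ∈ U
  smooth : MatrixSmoothOn (fun p : ℝ × ℝ => u p.1 p.2) U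
  perp : ∀ x t, (x, t) ∈ U → InCentralizerPerp a (u x t)
  family : IsAKNSFamily a b U u Q
  flow : ∀ x t, (x, t) ∈ U →
    matrixDeriv (fun s => u x s) t = matrixDeriv (fun y => Q j y t) x + ⁅u x t, Q j x t⁆

/-- `f` is a positive loop: an entire map `ℂ → GL(n,ℂ)`. -/
def IsPositiveLoop {n : ℕ} (f : ℂ → Matrix (Fin n) (Fin n) ℂ) : Prop :=
  MatrixHolomorphicOn f Set.univ ∧ ∀ z, IsUnit (f z)

/-- `E` is a trivialization of `u` on `U` (with `Q k = Q_{b,k}(u)`): it is smooth, its values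
`E(x,t,·)` are positive loops, and
`E⁻¹ E_x = a λ + u`, `E⁻¹ E_t = b λ^j + Q_{b,1}(u) λ^{j-1} + … + Q_{b,j}(u)`,
`E(0,0,λ) = Id`. -/
structure IsTrivialization {n : ℕ} (a b : Matrix (Fin n) (Fin n) ℂ) (j : ℕ)
    (U : Set (ℝ × ℝ)) (u : ℝ → ℝ → Matrix (Fin n) (Fin n) ℂ)
    (Q : ℕ → ℝ → ℝ → Matrix (Fin n) (Fin n) ℂ)
    (E : ℝ → ℝ → ℂ → Matrix (Fin n) (Fin n) ℂ) : Prop where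
  smooth : MatrixSmoothOn (fun p : (ℝ × ℝ) × ℂ => E p.1.1 p.1.2 p.2) (U ×ˢ Set.univ)
  positive : ∀ x t, (x, t) ∈ U → IsPositiveLoop (E x t)
  x_eq : ∀ x t, (x, t) ∈ U → ∀ z : ℂ,
    (E x t z)⁻¹ * matrixDeriv (fun y => E y t z) x = z • a + u x t
  t_eq : ∀ x t, (x, t) ∈ U → ∀ z : ℂ,
    (E x t z)⁻¹ * matrixDeriv (fun s => E x s z) t =
      z ^ j • b + ∑ k ∈ Finset.Icc 1 j, z ^ (j - k) • Q k x t
  initial : ∀ z : ℂ, E 0 0 z = 1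

/-- `w` (for `ω`) is a local reduced wave function on `U` for the trivialization `E`: for `λ` in a
neighbourhood `|λ| > R` of `∞` it is smooth, `GL(n,ℂ)`-valued and holomorphic in `λ`, also at
`λ = ∞` with `ω(x,t,∞) = Id`, and `E(x,t,λ) = ω(0,0,λ)⁻¹ exp(aλx + bλ^j t) ω(x,t,λ)`. -/
def IsLocalReducedWaveFunction {n : ℕ} (a b : Matrix (Fin n) (Fin n) ℂ) (j : ℕ)
    (U : Set (ℝ × ℝ)) (E w : ℝ → ℝ → ℂ → Matrix (Fin n) (Fin n) ℂ) : Prop :=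
  ∃ R : ℝ,
    MatrixSmoothOn (fun p : (ℝ × ℝ) × ℂ => w p.1.1 p.1.2 p.2) (U ×ˢ {z : ℂ | R < ‖z‖}) ∧
    ∀ x t, (x, t) ∈ U →
      MatrixHolomorphicOn (w x t) {z : ℂ | R < ‖z‖} ∧
      Filter.Tendsto (w x t) (Bornology.cobounded ℂ) (nhds 1) ∧
      ∀ z : ℂ, R < ‖z‖ → IsUnit (w x t z) ∧
        E x t z = (w 0 0 z)⁻¹ *
          NormedSpace.exp ((z * (x : ℂ)) • a + (z ^ j * (t : ℂ)) • b) * w x t z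

/-- The loop `m_{α,k,N}(λ) = Id + (λ - α)^{-k} N`. -/
noncomputable def nilpotentLoop {n : ℕ} (α : ℂ) (k : ℕ) (N : Matrix (Fin n) (Fin n) ℂ)
    (z : ℂ) : Matrix (Fin n) (Fin n) ℂ :=
  1 + (1 / (z - α)) ^ k • N

/-- `E_1(x,t) = d/dλ|_{λ=α} E(x,t,λ) E(x,t,α)⁻¹`. -/
noncomputable def dressingE₁ {n : ℕ} (E : ℝ → ℝ → ℂ → Matrix (Fin n) (Fin n) ℂ) (α : ℂ)
    (x t : ℝ) : Matrix (Fin n) (Fin n) ℂ :=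
  matrixDeriv (fun z : ℂ => E x t z * (E x t α)⁻¹) α

/-- `Ñ(x,t) = E(x,t,α)⁻¹ (Id + N E_1(x,t))⁻¹ N E(x,t,α)`. -/
noncomputable def dressedN {n : ℕ} (E : ℝ → ℝ → ℂ → Matrix (Fin n) (Fin n) ℂ) (α : ℂ)
    (N : Matrix (Fin n) (Fin n) ℂ) (x t : ℝ) : Matrix (Fin n) (Fin n) ℂ :=
  (E x t α)⁻¹ * (1 + N * dressingE₁ E α x t)⁻¹ * N * E x t α

/-- The points of `U` at which `Ñ` is well defined, i.e. `Id + N E_1(x,t)` is invertible. -/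
def dressedDomain {n : ℕ} (U : Set (ℝ × ℝ)) (E : ℝ → ℝ → ℂ → Matrix (Fin n) (Fin n) ℂ) (α : ℂ)
    (N : Matrix (Fin n) (Fin n) ℂ) : Set (ℝ × ℝ) :=
  {p | p ∈ U ∧ IsUnit (1 + N * dressingE₁ E α p.1 p.2)}

/-! The product `m_N E m_Ñ⁻¹` has at most a double pole at `λ = α`. Its principal part vanishes when
`(E(α) + N E'(α)) Ñ = N E(α)`: this kills the residue, and multiplying it by `N` gives `N E(α) Ñ =
0`, the double pole (`frame_identity`). The formula for `Ñ` is this relation solved for `Ñ`, and it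
also gives `Ñ² = 0` (`dressedN_relations`). Written with divided differences, the extension
`dressedFrame` is visibly entire in `λ` and jointly smooth.

Let `s` be `x` or `t`, and let `E_s = E B` with `B` polynomial in `λ`. Differentiating the relation
gives the Riccati equation `Ñ_s = Ñ B(α) - B(α) Ñ - Ñ B'(α) Ñ` (`matrixDeriv_dressedN`), which is
exactly what removes the pole of the gauge transform of `B` by `m_Ñ` (`gauge_identity`). For `B = aλ
+ u` the new coefficient is `aλ + u - [a, Ñ]`. For the `t`-equation, `B` is the polynomial part of
`λ^j ∑ Q_k λ^{-k}`, and the new coefficient is the polynomial part of the series conjugated by `m_Ñ`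
(`dressedFrame_geomShift`).

Hence the new `Q_k` are the coefficients `dressedSeq` of the conjugated series. Conjugacy to `b` is
immediate, and the recursion follows from the Riccati equation in `x` (`dressedSeq_recursion`). The
flow equation is the compatibility of the two linear equations (`IsTrivialization.flow_eq`). The
wave function formula rests on `Ñ(0,0) = N`. -/

/-! ### Real analysis: parameter integrals, divided differences, mixed partial derivatives. -/

section Analysis

open Set Filter Topology MeasureTheory

universe u

/-- Differentiation under the integral sign for a `C¹` integrand on a compact interval. -/
theorem hasFDerivAt_intervalIntegral_of_contDiffOn {X G : Type*} [NormedAddCommGroup X]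
    [NormedSpace ℝ X] [NormedAddCommGroup G] [NormedSpace ℝ G]
    {F : X → ℝ → G} {s : Set X} (hs : IsOpen s) (a b : ℝ)
    (hF : ContDiffOn ℝ 1 (fun p : X × ℝ => F p.1 p.2) (s ×ˢ univ)) {x : X} (hx : x ∈ s) :
    HasFDerivAt (fun y => ∫ r in a..b, F y r)
      (∫ r in a..b, (fderiv ℝ (fun p : X × ℝ => F p.1 p.2) (x, r)).comp
        (ContinuousLinearMap.inl ℝ X ℝ)) x := by
  set Φ : X × ℝ → G := fun p => F p.1 p.2 with hΦ
  have hopen : IsOpen (s ×ˢ (univ : Set ℝ)) := hs.prod isOpen_univ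
  have hcont : ContinuousOn (fderiv ℝ Φ) (s ×ˢ univ) :=
    hF.continuousOn_fderiv_of_isOpen hopen le_rfl
  have hcomp : ∀ y ∈ s, Continuous fun r : ℝ => fderiv ℝ Φ (y, r) := fun y hy =>
    hcont.comp_continuous (by fun_prop) fun r => ⟨hy, mem_univ r⟩
  have hFc : ∀ y ∈ s, Continuous (F y) := fun y hy =>
    hF.continuousOn.comp_continuous (f := fun r : ℝ => (y, r)) (by fun_prop)
      fun r => ⟨hy, mem_univ r⟩
  obtain ⟨C, hC⟩ : ∃ C, ∀ r ∈ uIcc a b, ‖fderiv ℝ Φ (x, r)‖ ≤ C :=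
    isCompact_uIcc.exists_bound_of_continuousOn (hcomp x hx).continuousOn
  have hW : IsOpen ((s ×ˢ (univ : Set ℝ)) ∩ (fun p => ‖fderiv ℝ Φ p‖) ⁻¹' Iio (C + 1)) :=
    hcont.norm.isOpen_inter_preimage hopen isOpen_Iio
  -- Compactness of the interval gives one neighbourhood of `x` on which the bound `C + 1` holds for
  -- all `r` at once.
  obtain ⟨V, V', hV, -, hxV, hV', hVW⟩ := generalized_tube_lemma
    (isCompact_singleton (x := x)) (isCompact_uIcc (a := a) (b := b)) hW (by
      rintro ⟨y, r⟩ ⟨rfl, hr⟩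
      exact ⟨⟨hx, mem_univ r⟩, (hC r hr).trans_lt (lt_add_one C)⟩)
  have hVx : V ∩ s ∈ 𝓝 x := inter_mem (hV.mem_nhds (hxV rfl)) (hs.mem_nhds hx)
  refine intervalIntegral.hasFDerivAt_integral_of_dominated_of_fderiv_le (bound := fun _ => C + 1)
    (F' := fun y r => (fderiv ℝ Φ (y, r)).comp (ContinuousLinearMap.inl ℝ X ℝ)) hVx ?_ ?_ ?_ ?_ ?_ ?_
  · filter_upwards [hs.mem_nhds hx] with y hy
    exact (hFc y hy).aestronglyMeasurable
  · exact (hFc x hx).intervalIntegrable _ _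
  · exact ((hcomp x hx).clm_comp continuous_const).aestronglyMeasurable
  · refine Eventually.of_forall fun r hr y hy => ?_
    have h1 : ‖fderiv ℝ Φ (y, r)‖ < C + 1 :=
      (hVW (mk_mem_prod hy.1 (hV' (uIoc_subset_uIcc hr)))).2
    refine (ContinuousLinearMap.opNorm_comp_le _ _).trans ?_
    calc _ ≤ ‖fderiv ℝ Φ (y, r)‖ * 1 := by
          gcongr; exact ContinuousLinearMap.norm_inl_le_one ℝ X ℝ
      _ ≤ C + 1 := by linarith
  · exact intervalIntegrable_const
  · refine Eventually.of_forall fun r _ y hy => ?_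
    have h1 : HasFDerivAt Φ (fderiv ℝ Φ (y, r)) (y, r) :=
      ((hF.differentiableOn one_ne_zero).differentiableAt
        (hopen.mem_nhds ⟨hy.2, mem_univ r⟩)).hasFDerivAt
    exact HasFDerivAt.comp (f := fun e => (e, r)) y h1 (hasFDerivAt_prodMk_left y r)

/-- Induction on `m`: the derivative is again a parameter integral, of a partial derivative that has
lost one order. The induction changes `G` into a space of linear maps `X →L[ℝ] G`, hence the common
universe. -/
theorem contDiffOn_nat_intervalIntegral {X G : Type u} [NormedAddCommGroup X]
    [NormedSpace ℝ X] [NormedAddCommGroup G] [NormedSpace ℝ G]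
    {F : X → ℝ → G} {s : Set X} (hs : IsOpen s) (a b : ℝ) (m : ℕ)
    (hF : ContDiffOn ℝ (m + 1) (fun p : X × ℝ => F p.1 p.2) (s ×ˢ univ)) :
    ContDiffOn ℝ m (fun y => ∫ r in a..b, F y r) s := by
  have hopen : IsOpen (s ×ˢ (univ : Set ℝ)) := hs.prod isOpen_univ
  have hd : ∀ x ∈ s, _ := fun x hx => hasFDerivAt_intervalIntegral_of_contDiffOn hs a b
    (hF.of_le (by simp)) hx
  induction m generalizing G with
  | zero =>
    exact contDiffOn_zero.2 fun x hx => (hd x hx).continuousAt.continuousWithinAt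
  | succ m ih =>
    push_cast at hF ⊢
    refine (contDiffOn_succ_iff_fderiv_of_isOpen hs).2
      ⟨fun x hx => (hd x hx).differentiableAt.differentiableWithinAt, by simp, ?_⟩
    have h1 : ContDiffOn ℝ (m + 1) (fun p : X × ℝ =>
        (fderiv ℝ (fun p : X × ℝ => F p.1 p.2) (p.1, p.2)).comp
          (ContinuousLinearMap.inl ℝ X ℝ)) (s ×ˢ univ) :=
      (hF.fderiv_of_isOpen hopen le_rfl).clm_comp contDiffOn_const
    exact (ih h1 fun x hx => hasFDerivAt_intervalIntegral_of_contDiffOn hs a b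
      (h1.of_le (by simp)) hx).congr fun x hx => (hd x hx).fderiv

/-- An integral of a smooth function over a compact interval depends smoothly on parameters. -/
theorem contDiffOn_intervalIntegral {X G : Type u} [NormedAddCommGroup X]
    [NormedSpace ℝ X] [NormedAddCommGroup G] [NormedSpace ℝ G]
    {F : X → ℝ → G} {s : Set X} (hs : IsOpen s) (a b : ℝ)
    (hF : ContDiffOn ℝ ∞ (fun p : X × ℝ => F p.1 p.2) (s ×ˢ univ)) :
    ContDiffOn ℝ ∞ (fun y => ∫ r in a..b, F y r) s :=
  contDiffOn_infty.2 fun m => contDiffOn_nat_intervalIntegral hs a b m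
    (hF.of_le (by exact_mod_cast le_top))

/-- The fundamental theorem of calculus on the segment from `α` to `z`. The integral needs no case
distinction at `z = α`, so smoothness there comes for free. -/
theorem dslope_eq_integral_deriv {f : ℂ → ℂ} (hf : Differentiable ℂ f) (α z : ℂ) :
    dslope f α z = ∫ r in (0 : ℝ)..1, deriv f (α + r • (z - α)) := by
  rcases eq_or_ne z α with rfl | hz
  · simp
  have hc : Continuous (deriv f) := (hf.contDiff (n := 1)).continuous_deriv le_rfl
  have h := intervalIntegral.integral_unitInterval_deriv_eq_sub (f := f) (f' := deriv f)
    (z₀ := α) (z₁ := z - α)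
    (Continuous.continuousOn (by fun_prop)) fun t _ => (hf _).hasDerivAt
  rw [add_sub_cancel, smul_eq_mul] at h
  rw [dslope_of_ne _ hz, slope_def_field, ← h, mul_div_cancel_left₀ _ (sub_ne_zero.2 hz)]

/-- The divided difference of a smooth family of entire functions is smooth. -/
theorem ContDiffOn.dslope_prod {X : Type} [NormedAddCommGroup X] [NormedSpace ℝ X]
    {f : X → ℂ → ℂ} {s : Set X} (hs : IsOpen s) (α : ℂ)
    (hf : ContDiffOn ℝ ∞ (fun p : X × ℂ => f p.1 p.2) (s ×ˢ univ))
    (hd : ∀ x ∈ s, Differentiable ℂ (f x)) :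
    ContDiffOn ℝ ∞ (fun p : X × ℂ => dslope (f p.1) α p.2) (s ×ˢ univ) := by
  have hopen : IsOpen (s ×ˢ (univ : Set ℂ)) := hs.prod isOpen_univ
  -- The complex derivative is the real Fréchet derivative in the direction `(0, 1)`.
  have h1 : ContDiffOn ℝ ∞ (fun p : X × ℂ => deriv (f p.1) p.2) (s ×ˢ univ) := by
    have h2 : ContDiffOn ℝ ∞ (fun p : X × ℂ =>
        fderiv ℝ (fun p : X × ℂ => f p.1 p.2) p ((0 : X), (1 : ℂ))) (s ×ˢ univ) :=
      (hf.fderiv_of_isOpen hopen (by simp)).clm_apply contDiffOn_const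
    refine h2.congr fun p hp => ?_
    have h3 : HasFDerivAt (fun p : X × ℂ => f p.1 p.2) _ (p.1, p.2) :=
      ((hf.differentiableOn (by simp)).differentiableAt (hopen.mem_nhds hp)).hasFDerivAt
    have h4 := h3.comp p.2 (hasFDerivAt_prodMk_right p.1 p.2)
    have h5 := (hd p.1 hp.1 p.2).hasDerivAt.hasFDerivAt.restrictScalars ℝ
    simpa using congrArg (fun L => L 1) (h5.unique h4)
  have h2 : ContDiffOn ℝ ∞ (fun q : (X × ℂ) × ℝ =>
      deriv (f q.1.1) (α + q.2 • (q.1.2 - α))) ((s ×ˢ univ) ×ˢ univ) :=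
    h1.comp (f := fun q : (X × ℂ) × ℝ => (q.1.1, α + q.2 • (q.1.2 - α)))
      (ContDiff.contDiffOn (by fun_prop)) fun q hq => ⟨hq.1.1, mem_univ _⟩
  exact (contDiffOn_intervalIntegral
    (F := fun (p : X × ℂ) (r : ℝ) => deriv (f p.1) (α + r • (p.2 - α))) hopen 0 1 h2).congr
    fun p hp => dslope_eq_integral_deriv (hd p.1 hp.1) α p.2

/-- Partial derivatives commute. -/
theorem ContDiffAt.hasDerivAt_partial_swap {𝕜 G : Type*} [NontriviallyNormedField 𝕜]
    [NormedAlgebra ℝ 𝕜] [NormedAddCommGroup G] [NormedSpace ℝ G] [NormedSpace 𝕜 G]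
    [IsScalarTower ℝ 𝕜 G] {f : ℝ → 𝕜 → G} {f₁ : 𝕜 → G} {f₂ : ℝ → G} {d : G} {a : ℝ} {b : 𝕜}
    (hf : ContDiffAt ℝ 2 (fun p : ℝ × 𝕜 => f p.1 p.2) (a, b))
    (h₁ : ∀ᶠ y in 𝓝 b, HasDerivAt (fun x => f x y) (f₁ y) a)
    (h₂ : ∀ᶠ x in 𝓝 a, HasDerivAt (fun y => f x y) (f₂ x) b)
    (h : HasDerivAt f₁ d b) : HasDerivAt f₂ d a := by
  set Φ : ℝ × 𝕜 → G := fun p => f p.1 p.2 with hΦ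
  have hev : ∀ᶠ p in 𝓝 (a, b), HasFDerivAt Φ (fderiv ℝ Φ p) p := by
    filter_upwards [hf.eventually (by simp)] with p hp
    exact (hp.differentiableAt two_ne_zero).hasFDerivAt
  have hsymm : IsSymmSndFDerivAt ℝ Φ (a, b) := hf.isSymmSndFDerivAt (by simp)
  have hD : HasFDerivAt (fderiv ℝ Φ) (fderiv ℝ (fderiv ℝ Φ) (a, b)) (a, b) :=
    ((hf.fderiv_right (m := 1) (by norm_num)).differentiableAt one_ne_zero).hasFDerivAt
  -- Both partial derivatives are real directional derivatives, even when `𝕜 = ℂ`, so symmetry of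
  -- the real second derivative suffices.
  have e₁ : f₁ =ᶠ[𝓝 b] fun y => fderiv ℝ Φ (a, y) (1, 0) := by
    have hcont : ContinuousAt (fun y : 𝕜 => (a, y)) b := by fun_prop
    filter_upwards [h₁, hcont.eventually hev] with y hy hy'
    have := (HasFDerivAt.comp (f := fun e => (e, y)) a hy' (hasFDerivAt_prodMk_left a y)).unique hy.hasFDerivAt
    simpa using (congrArg (fun L => L 1) this).symm
  have e₂ : f₂ =ᶠ[𝓝 a] fun x => fderiv ℝ Φ (x, b) (0, 1) := by
    have hcont : ContinuousAt (fun x : ℝ => (x, b)) a := by fun_prop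
    filter_upwards [h₂, hcont.eventually hev] with x hx hx'
    have := (HasFDerivAt.comp (f := fun e => (x, e)) b hx' (hasFDerivAt_prodMk_right x b)).unique
      (hx.hasFDerivAt.restrictScalars ℝ)
    simpa using (congrArg (fun L => L 1) this).symm
  have k₁ : HasFDerivAt (fun y => fderiv ℝ Φ (a, y) (1, 0)) _ b :=
    (HasFDerivAt.comp (f := fun e => (a, e)) b hD (hasFDerivAt_prodMk_right a b)).clm_apply (hasFDerivAt_const _ _)
  have k₂ : HasFDerivAt (fun x => fderiv ℝ Φ (x, b) (0, 1)) _ a :=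
    (HasFDerivAt.comp (f := fun e => (e, b)) a hD (hasFDerivAt_prodMk_left a b)).clm_apply (hasFDerivAt_const _ _)
  have hd : d = fderiv ℝ (fderiv ℝ Φ) (a, b) (0, 1) (1, 0) := by
    have := (k₁.congr_of_eventuallyEq e₁).unique (h.hasFDerivAt.restrictScalars ℝ)
    simpa using (congrArg (fun L => L 1) this).symm
  have := (k₂.congr_of_eventuallyEq e₂).hasDerivAt
  rw [hd, hsymm.eq]
  simpa using this

end Analysis

/-! ### Algebra of the dressed coefficients in a noncommutative ring. -/

section DressingAlgebra

variable {R : Type*} [Ring R] [Algebra ℂ R]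

/-- The coefficients of `(λ - α)⁻¹ ∑ q_k λ^{-k}`, expanded in powers of `λ⁻¹`. -/
def geomShift (α : ℂ) (q : ℕ → R) : ℕ → R
  | 0 => 0
  | k + 1 => α • geomShift α q k + q k

@[simp] theorem geomShift_zero (α : ℂ) (q : ℕ → R) : geomShift α q 0 = 0 := rfl

theorem geomShift_succ (α : ℂ) (q : ℕ → R) (k : ℕ) :
    geomShift α q (k + 1) = α • geomShift α q k + q k := rfl

/-- The resolvent identity for `(λ - z)⁻¹` and `(λ - α)⁻¹`, by coefficients. As a statement about
polynomials in `z`, it computes the divided difference of `geomShift z q k` at `α`. -/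
theorem sub_smul_geomShift_geomShift (α z : ℂ) (q : ℕ → R) (k : ℕ) :
    (z - α) • geomShift z (geomShift α q) k = geomShift z q k - geomShift α q k := by
  induction k with
  | zero => simp
  | succ k ih =>
    rw [geomShift_succ, geomShift_succ, geomShift_succ, smul_add, smul_comm, ih]
    module

/-- This recognises the right side of the `t`-equation as a `geomShift`; the index is `j + 1`
because a polynomial of degree `j` has `j + 1` coefficients. -/
theorem geomShift_succ_eq_sum (z : ℂ) (q : ℕ → R) (j : ℕ) :
    geomShift z q (j + 1) = z ^ j • q 0 + ∑ k ∈ Finset.Icc 1 j, z ^ (j - k) • q k := by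
  induction j with
  | zero => simp [geomShift_succ]
  | succ j ih =>
    rw [geomShift_succ, ih, Finset.sum_Icc_succ_top (by omega), smul_add, Finset.smul_sum]
    have : ∑ k ∈ Finset.Icc 1 j, z ^ (j + 1 - k) • q k =
        ∑ k ∈ Finset.Icc 1 j, z • z ^ (j - k) • q k := by
      refine Finset.sum_congr rfl fun k hk => ?_
      rw [Nat.succ_sub (Finset.mem_Icc.1 hk).2, pow_succ', mul_smul]
    rw [this, pow_succ', mul_smul]
    simp [add_assoc]

/-- The coefficients of `(1 + (λ - α)⁻¹ N) (∑ q_k λ^{-k}) (1 - (λ - α)⁻¹ N)`. -/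
def dressedSeq (α : ℂ) (N : R) (q : ℕ → R) (k : ℕ) : R :=
  q k + N * geomShift α q k - geomShift α q k * N - N * geomShift α (geomShift α q) k * N

/-- Dressing commutes with taking the polynomial part, since `geomShift z` is linear and commutes
with multiplication by the fixed `N`. -/
theorem geomShift_dressedSeq (α z : ℂ) (N : R) (q : ℕ → R) (k : ℕ) :
    geomShift z (dressedSeq α N q) k = geomShift z q k + N * geomShift z (geomShift α q) k
      - geomShift z (geomShift α q) k * N
      - N * geomShift z (geomShift α (geomShift α q)) k * N := by
  induction k with
  | zero => simp
  | succ k ih =>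
    simp only [geomShift_succ z, ih, dressedSeq, mul_add, add_mul, smul_sub, smul_add,
      mul_smul_comm, smul_mul_assoc]
    abel

/-- Here `c = (z - α)⁻¹`, `B₀ = B(α)`, `B₁ = B'(α)`, and `Bp`, `Bpp` are the first and second
divided differences of `B` at `α`. The bracket multiplied by `c` is the Riccati derivative of `N`,
so the left side is `B m⁻¹ + (m⁻¹)_s` for `m = 1 + cN`. The second factor on the right is the
pole-free gauge transform of `B`. -/
theorem gauge_identity {N B B₀ B₁ Bp Bpp : R} {c : ℂ} (hN : N * N = 0)
    (h₁ : c • (B - B₀) = Bp) (h₂ : c • (Bp - B₁) = Bpp) :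
    B * (1 - c • N) - c • (N * B₀ - B₀ * N - N * B₁ * N) =
      (1 - c • N) * (B + N * Bp - Bp * N - N * Bpp * N) := by
  have hN' : ∀ X : R, N * (N * X) = 0 := fun X => by rw [← mul_assoc, hN, zero_mul]
  have e : c • B = Bp + c • B₀ := by rw [← h₁, smul_sub]; abel
  have e' : c • Bp = Bpp + c • B₁ := by rw [← h₂, smul_sub]; abel
  simp only [mul_sub, sub_mul, mul_add, mul_one, one_mul, mul_smul_comm, smul_mul_assoc, smul_sub,
    mul_assoc, hN', smul_zero]
  have f₁ : c • (B * N) = Bp * N + c • (B₀ * N) := by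
    rw [← smul_mul_assoc, e, add_mul, smul_mul_assoc]
  have f₂ : c • (N * B) = N * Bp + c • (N * B₀) := by
    rw [← mul_smul_comm, e, mul_add, mul_smul_comm]
  have f₃ : c • (N * (Bp * N)) = N * (Bpp * N) + c • (N * (B₁ * N)) := by
    rw [← mul_smul_comm, ← smul_mul_assoc, e', add_mul, mul_add, smul_mul_assoc, mul_smul_comm]
  rw [f₁, f₂, f₃]
  abel

/-- The dressed sequence satisfies the dressed recursion. -/
theorem dressedSeq_recursion {α : ℂ} {N a u : R} (hN : N * N = 0) (q : ℕ → R) (k : ℕ) :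
    ((q (k + 1) * a - a * q (k + 1)) - (u * q k - q k * u)) +
      ((N * (α • a + u) - (α • a + u) * N - N * a * N) * geomShift α q k +
        N * ((geomShift α q (k + 1) * a - a * geomShift α q (k + 1)) -
          (u * geomShift α q k - geomShift α q k * u))) -
      (((geomShift α q (k + 1) * a - a * geomShift α q (k + 1)) -
          (u * geomShift α q k - geomShift α q k * u)) * N +
        geomShift α q k * (N * (α • a + u) - (α • a + u) * N - N * a * N)) -
      (((N * (α • a + u) - (α • a + u) * N - N * a * N) * geomShift α (geomShift α q) k +
        N * ((geomShift α (geomShift α q) (k + 1) * a - a * geomShift α (geomShift α q) (k + 1)) -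
          (u * geomShift α (geomShift α q) k - geomShift α (geomShift α q) k * u))) * N +
        N * geomShift α (geomShift α q) k *
          (N * (α • a + u) - (α • a + u) * N - N * a * N)) +
      ⁅u - ⁅a, N⁆, dressedSeq α N q k⁆ = ⁅dressedSeq α N q (k + 1), a⁆ := by
  have hN' : ∀ X : R, N * (N * X) = 0 := fun X => by rw [← mul_assoc, hN, zero_mul]
  simp only [dressedSeq, geomShift_succ, Ring.lie_def]
  -- What remains is an identity between free noncommuting letters modulo `N² = 0`; no property of
  -- `q` enters.
  generalize geomShift α (geomShift α q) k = H
  generalize geomShift α q k = G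
  generalize q k = p
  generalize q (k + 1) = p'
  simp only [mul_sub, sub_mul, mul_add, add_mul, mul_smul_comm, smul_mul_assoc,
    mul_assoc, hN', mul_zero]
  abel

/-! ### The dressed coefficients as a conjugated power series in `λ⁻¹`. -/

section PowerSeries

open PowerSeries

/-- The power series of `(λ - α)⁻¹` in the variable `λ⁻¹`. -/
def geomSeries (R : Type*) [Ring R] [Algebra ℂ R] (α : ℂ) : PowerSeries R :=
  PowerSeries.mk fun k => (if k = 0 then 0 else α ^ (k - 1) : ℂ) • (1 : R)

theorem geomSeries_mul_mk (α : ℂ) (q : ℕ → R) :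
    geomSeries R α * PowerSeries.mk q = PowerSeries.mk (geomShift α q) := by
  ext k
  induction k with
  | zero => simp [geomSeries, PowerSeries.coeff_mul]
  | succ k ih =>
    rw [PowerSeries.coeff_mk, geomShift_succ, ← PowerSeries.coeff_mk k (geomShift α q), ← ih,
      PowerSeries.coeff_mul, PowerSeries.coeff_mul, Finset.Nat.sum_antidiagonal_succ]
    cases k with
    | zero => simp [geomSeries]
    | succ k =>
      rw [Finset.Nat.sum_antidiagonal_succ, Finset.Nat.sum_antidiagonal_succ]
      simp [geomSeries, Finset.smul_sum, pow_succ', mul_smul, add_comm]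

/-- All coefficients of `geomSeries` are scalar multiples of `1`, so it is central. -/
theorem geomSeries_commute (α : ℂ) (f : PowerSeries R) :
    geomSeries R α * f = f * geomSeries R α := by
  ext k
  rw [PowerSeries.coeff_mul, PowerSeries.coeff_mul, ← Finset.Nat.sum_antidiagonal_swap]
  simp [geomSeries]

theorem mk_dressedSeq (α : ℂ) (N : R) (q : ℕ → R) :
    PowerSeries.mk (dressedSeq α N q) =
      (1 + C N * geomSeries R α) * PowerSeries.mk q * (1 - C N * geomSeries R α) := by
  have h₁ := geomSeries_mul_mk α q
  have h₂ := geomSeries_mul_mk α (geomShift α q)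
  have e : (1 + C N * geomSeries R α) * PowerSeries.mk q * (1 - C N * geomSeries R α) =
      PowerSeries.mk q + C N * (geomSeries R α * PowerSeries.mk q) -
        (geomSeries R α * PowerSeries.mk q) * C N -
        C N * (geomSeries R α * (geomSeries R α * PowerSeries.mk q)) * C N := by
    have h₃ := fun f : PowerSeries R => (geomSeries_commute α f).symm
    have h₄ : ∀ f g : PowerSeries R, f * (geomSeries R α * g) = geomSeries R α * (f * g) :=
      fun f g => by rw [← mul_assoc, h₃, mul_assoc]
    simp only [mul_sub, mul_one, add_mul, one_mul, mul_assoc, h₃ (C N), h₄ (C N), h₄ (mk q)]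
    abel
  rw [e, h₁, h₂]
  ext k
  simp [dressedSeq]

/-- Since `N² = 0`, the two outer factors in `mk_dressedSeq` are inverse to each other; the
conjugator for `q` is multiplied by the first. -/
theorem dressedSeq_conjugate {α : ℂ} {N b : R} (hN : N * N = 0) {q : ℕ → R}
    (h : ∃ M : (PowerSeries R)ˣ, PowerSeries.mk q =
      (M : PowerSeries R) * C b * ((M⁻¹ : (PowerSeries R)ˣ) : PowerSeries R)) :
    ∃ M : (PowerSeries R)ˣ, PowerSeries.mk (dressedSeq α N q) =
      (M : PowerSeries R) * C b * ((M⁻¹ : (PowerSeries R)ˣ) : PowerSeries R) := by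
  obtain ⟨M, hM⟩ := h
  have hsq : C N * geomSeries R α * (C N * geomSeries R α) = 0 := by
    rw [← geomSeries_commute α (C N), mul_assoc, ← mul_assoc (C N),
      ← geomSeries_commute α (C N), mul_assoc, ← map_mul, hN]
    simp
  let P : (PowerSeries R)ˣ :=
    ⟨1 + C N * geomSeries R α, 1 - C N * geomSeries R α,
      by rw [mul_sub, add_mul, add_mul, hsq]; simp,
      by rw [mul_add, sub_mul, sub_mul, hsq]; simp⟩
  refine ⟨P * M, ?_⟩
  rw [mk_dressedSeq, hM, mul_inv_rev]
  simp only [Units.val_mul, mul_assoc]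
  rfl

end PowerSeries

end DressingAlgebra

/-! ### Commutation of the shift with the recursion, and cancellation of the pole of the frame. -/

section FrameAlgebra

variable {R : Type*} [Ring R] [Algebra ℂ R]

/-- Multiplication by the scalar series `(λ - α)⁻¹` commutes with `q ↦ λ[q, a] - [u, q]`. The index
shift drops the coefficient `[q 0, a]`, which must therefore vanish. -/
theorem geomShift_commutator {α : ℂ} {a u : R} {q : ℕ → R} (h₀ : q 0 * a - a * q 0 = 0) :
    geomShift α (fun k => (q (k + 1) * a - a * q (k + 1)) - (u * q k - q k * u)) =
      fun k => (geomShift α q (k + 1) * a - a * geomShift α q (k + 1)) -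
        (u * geomShift α q k - geomShift α q k * u) := by
  funext k
  induction k with
  | zero => simp [geomShift_succ, h₀]
  | succ k ih =>
    rw [geomShift_succ, ih, geomShift_succ α q (k + 1), geomShift_succ α q k]
    simp only [mul_add, add_mul, smul_sub, smul_add, mul_smul_comm, smul_mul_assoc]
    abel

/-- `F₀`, `F₁` are the value and derivative at `α`, and `Fp`, `Fpp` the divided differences.
Hypothesis `h` says that the residue `N F₀ - F₀ N' - N F₁ N'` vanishes; multiplied by `N`, it gives
`N F₀ N' = 0`, the coefficient of the double pole. -/
theorem frame_identity {N N' F F₀ F₁ Fp Fpp : R} {c : ℂ} (hN : N * N = 0)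
    (h : (F₀ + N * F₁) * N' = N * F₀) (h₁ : c • (F - F₀) = Fp) (h₂ : c • (Fp - F₁) = Fpp) :
    F + N * Fp - Fp * N' - N * Fpp * N' = (1 + c • N) * F * (1 - c • N') := by
  have hNN : ∀ X : R, N * (N * X) = 0 := fun X => by rw [← mul_assoc, hN, zero_mul]
  have e : c • F = Fp + c • F₀ := by rw [← h₁, smul_sub]; abel
  have e' : c • Fp = Fpp + c • F₁ := by rw [← h₂, smul_sub]; abel
  have h₃ : N * (F₀ * N') = 0 := by
    have := congrArg (N * ·) h
    simpa [add_mul, mul_add, mul_assoc, hNN] using this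
  have h₄ : F₀ * N' + N * (F₁ * N') = N * F₀ := by rw [← h, add_mul, mul_assoc]
  have f₁ : c • (N * F) = N * Fp + c • (N * F₀) := by
    rw [← mul_smul_comm, e, mul_add, mul_smul_comm]
  have f₂ : c • (F * N') = Fp * N' + c • (F₀ * N') := by
    rw [← smul_mul_assoc, e, add_mul, smul_mul_assoc]
  have f₃ : c • (N * (F * N')) = N * (Fp * N') := by
    rw [← mul_smul_comm, f₂, mul_add, mul_smul_comm, h₃, smul_zero, add_zero]
  have f₄ : c • (N * (Fp * N')) = N * (Fpp * N') + c • (N * (F₁ * N')) := by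
    rw [← mul_smul_comm, ← smul_mul_assoc, e', add_mul, mul_add, smul_mul_assoc, mul_smul_comm]
  simp only [add_mul, mul_sub, mul_one, one_mul, mul_smul_comm, smul_mul_assoc, mul_assoc]
  have f₅ : c • (F₀ * N') + c • (N * (F₁ * N')) = c • (N * F₀) := by rw [← smul_add, h₄]
  rw [f₁, smul_add, f₃, f₂, f₄, ← f₅]
  abel

end FrameAlgebra

/-! ### Entrywise calculus of matrix-valued maps. -/

section MatrixCalculus

open Set Filter Topology Matrix

variable {n : ℕ}

/-- Entrywise derivative of a matrix-valued map. -/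
def MatrixHasDerivAt {𝕜 : Type*} [NontriviallyNormedField 𝕜] [NormedSpace 𝕜 ℂ]
    (f : 𝕜 → Matrix (Fin n) (Fin n) ℂ) (f' : Matrix (Fin n) (Fin n) ℂ) (x : 𝕜) : Prop :=
  ∀ i k, HasDerivAt (fun y => f y i k) (f' i k) x

namespace MatrixHasDerivAt

variable {𝕜 : Type*} [NontriviallyNormedField 𝕜] [NormedAlgebra 𝕜 ℂ]
  {f g : 𝕜 → Matrix (Fin n) (Fin n) ℂ} {f' g' : Matrix (Fin n) (Fin n) ℂ} {x : 𝕜}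

theorem matrixDeriv_eq (h : MatrixHasDerivAt f f' x) : matrixDeriv f x = f' := by
  ext i k
  exact (h i k).deriv

theorem unique (h : MatrixHasDerivAt f f' x) (h' : MatrixHasDerivAt f g' x) : f' = g' := by
  rw [← h.matrixDeriv_eq, h'.matrixDeriv_eq]

theorem congr_of_eventuallyEq (h : MatrixHasDerivAt f f' x) (hfg : g =ᶠ[𝓝 x] f) :
    MatrixHasDerivAt g f' x := fun i k =>
  (h i k).congr_of_eventuallyEq (hfg.mono fun y hy => by simp [hy])

theorem congr_deriv (h : MatrixHasDerivAt f f' x) (e : f' = g') : MatrixHasDerivAt f g' x := e ▸ h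

theorem const (c : Matrix (Fin n) (Fin n) ℂ) : MatrixHasDerivAt (fun _ : 𝕜 => c) 0 x :=
  fun _ _ => hasDerivAt_const _ _

theorem add (hf : MatrixHasDerivAt f f' x) (hg : MatrixHasDerivAt g g' x) :
    MatrixHasDerivAt (fun y => f y + g y) (f' + g') x := fun i k => (hf i k).add (hg i k)

theorem sub (hf : MatrixHasDerivAt f f' x) (hg : MatrixHasDerivAt g g' x) :
    MatrixHasDerivAt (fun y => f y - g y) (f' - g') x := fun i k => (hf i k).sub (hg i k)

theorem const_smul (c : ℂ) (hf : MatrixHasDerivAt f f' x) :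
    MatrixHasDerivAt (fun y => c • f y) (c • f') x := fun i k => (hf i k).const_mul c

theorem mul (hf : MatrixHasDerivAt f f' x) (hg : MatrixHasDerivAt g g' x) :
    MatrixHasDerivAt (fun y => f y * g y) (f' * g x + f x * g') x := fun i k => by
  simp only [Matrix.mul_apply, Matrix.add_apply, ← Finset.sum_add_distrib]
  exact HasDerivAt.fun_sum fun l _ => (hf i l).mul (hg l k)

theorem const_mul (c : Matrix (Fin n) (Fin n) ℂ) (hf : MatrixHasDerivAt f f' x) :
    MatrixHasDerivAt (fun y => c * f y) (c * f') x := by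
  simpa using (const (𝕜 := 𝕜) c).mul hf

theorem mul_const (hf : MatrixHasDerivAt f f' x) (c : Matrix (Fin n) (Fin n) ℂ) :
    MatrixHasDerivAt (fun y => f y * c) (f' * c) x := by
  simpa using hf.mul (const (𝕜 := 𝕜) c)

theorem geomShift {α : ℂ} {q : 𝕜 → ℕ → Matrix (Fin n) (Fin n) ℂ}
    {q' : ℕ → Matrix (Fin n) (Fin n) ℂ} (hq : ∀ k, MatrixHasDerivAt (fun y => q y k) (q' k) x)
    (k : ℕ) :
    MatrixHasDerivAt (fun y => _root_.geomShift α (q y) k) (_root_.geomShift α q' k) x := by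
  induction k with
  | zero => exact const 0
  | succ k ih => exact (ih.const_smul α).add (hq k)

/-- The case `z → α` of the resolvent identity: the derivative of `(λ - z)⁻¹` in `z` is its square.
-/
theorem geomShift_param (q : ℕ → Matrix (Fin n) (Fin n) ℂ) (α : ℂ) (k : ℕ) :
    MatrixHasDerivAt (fun z : ℂ => _root_.geomShift z q k)
      (_root_.geomShift α (_root_.geomShift α q) k) α := by
  induction k with
  | zero => exact const 0
  | succ k ih =>
    intro i l
    have := ((hasDerivAt_id α).mul (ih i l)).add_const (q k i l)
    simpa [geomShift_succ, add_comm] using this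

end MatrixHasDerivAt

variable {X : Type*} [NormedAddCommGroup X] [NormedSpace ℝ X]
  {f g : X → Matrix (Fin n) (Fin n) ℂ} {S T : Set X}

namespace MatrixSmoothOn

theorem const (c : Matrix (Fin n) (Fin n) ℂ) : MatrixSmoothOn (fun _ : X => c) S :=
  fun _ _ => contDiffOn_const

theorem add (hf : MatrixSmoothOn f S) (hg : MatrixSmoothOn g S) :
    MatrixSmoothOn (fun p => f p + g p) S := fun i k => (hf i k).add (hg i k)

theorem sub (hf : MatrixSmoothOn f S) (hg : MatrixSmoothOn g S) :
    MatrixSmoothOn (fun p => f p - g p) S := fun i k => (hf i k).sub (hg i k)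

theorem smul {c : X → ℂ} (hc : ContDiffOn ℝ ∞ c S) (hf : MatrixSmoothOn f S) :
    MatrixSmoothOn (fun p => c p • f p) S := fun i k => hc.mul (hf i k)

theorem mul (hf : MatrixSmoothOn f S) (hg : MatrixSmoothOn g S) :
    MatrixSmoothOn (fun p => f p * g p) S := fun i k => by
  simp only [Matrix.mul_apply]
  exact ContDiffOn.sum fun l _ => (hf i l).mul (hg l k)

theorem mono (hf : MatrixSmoothOn f S) (h : T ⊆ S) : MatrixSmoothOn f T :=
  fun i k => (hf i k).mono h

theorem congr (hf : MatrixSmoothOn f S) (h : ∀ p ∈ S, g p = f p) : MatrixSmoothOn g S :=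
  fun i k => (hf i k).congr fun p hp => by rw [h p hp]

theorem comp {Y : Type*} [NormedAddCommGroup Y] [NormedSpace ℝ Y] {T : Set Y} {φ : Y → X}
    (hf : MatrixSmoothOn f S) (hφ : ContDiff ℝ ∞ φ) (h : MapsTo φ T S) :
    MatrixSmoothOn (fun p => f (φ p)) T := fun i k => (hf i k).comp hφ.contDiffOn h

theorem det (hf : MatrixSmoothOn f S) : ContDiffOn ℝ ∞ (fun p => (f p).det) S := by
  simp only [Matrix.det_apply']
  exact ContDiffOn.sum fun σ _ => contDiffOn_const.mul (contDiffOn_prod fun i _ => hf _ _)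

theorem inv (hf : MatrixSmoothOn f S) (h : ∀ p ∈ S, IsUnit (f p)) :
    MatrixSmoothOn (fun p => (f p)⁻¹) S := fun i k => by
  -- Cramer's rule: the determinants of these matrices are the adjugate entries.
  have h₁ : MatrixSmoothOn (fun p => (f p).updateRow k (Pi.single i 1)) S := fun l m => by
    by_cases hl : l = k
    · subst hl; simpa using contDiffOn_const
    · simpa [Matrix.updateRow_ne hl] using hf l m
  simp only [Matrix.inv_def, Matrix.smul_apply, Matrix.adjugate_apply, Ring.inverse_eq_inv',
    smul_eq_mul]
  exact (hf.det.inv fun p hp => ((Matrix.isUnit_iff_isUnit_det _).1 (h p hp)).ne_zero).mul h₁.det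

theorem geomShift {α : ℂ} {q : X → ℕ → Matrix (Fin n) (Fin n) ℂ}
    (hq : ∀ k, MatrixSmoothOn (fun p => q p k) S) (k : ℕ) :
    MatrixSmoothOn (fun p => _root_.geomShift α (q p) k) S := by
  induction k with
  | zero => exact const 0
  | succ k ih => exact (smul contDiffOn_const ih).add (hq k)

theorem matrixHasDerivAt {f : ℝ → Matrix (Fin n) (Fin n) ℂ} {S : Set ℝ} (hf : MatrixSmoothOn f S)
    {x : ℝ} (hx : S ∈ 𝓝 x) : MatrixHasDerivAt f (matrixDeriv f x) x := fun i k =>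
  (((hf i k).contDiffAt hx).differentiableAt (by simp)).hasDerivAt

end MatrixSmoothOn

theorem MatrixHolomorphicOn.matrixHasDerivAt {f : ℂ → Matrix (Fin n) (Fin n) ℂ}
    (hf : MatrixHolomorphicOn f univ) (z : ℂ) : MatrixHasDerivAt f (matrixDeriv f z) z :=
  fun i k => ((hf i k).differentiableAt univ_mem).hasDerivAt

/-- The entrywise divided difference `(f(z) - f(α)) / (z - α)`, extended by the derivative at `α`. -/
noncomputable def matrixDslope (f : ℂ → Matrix (Fin n) (Fin n) ℂ) (α z : ℂ) :
    Matrix (Fin n) (Fin n) ℂ :=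
  Matrix.of fun i k => dslope (fun y => f y i k) α z

theorem matrixDslope_same (f : ℂ → Matrix (Fin n) (Fin n) ℂ) (α : ℂ) :
    matrixDslope f α α = matrixDeriv f α := by
  ext i k
  exact dslope_same _ _

theorem smul_sub_eq_matrixDslope (f : ℂ → Matrix (Fin n) (Fin n) ℂ) {α z : ℂ} (h : z ≠ α) :
    (1 / (z - α)) • (f z - f α) = matrixDslope f α z := by
  ext i k
  simp [matrixDslope, dslope_of_ne _ h, slope_def_field, div_eq_inv_mul]

theorem MatrixHolomorphicOn.matrixDslope {f : ℂ → Matrix (Fin n) (Fin n) ℂ}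
    (hf : MatrixHolomorphicOn f univ) (α : ℂ) : MatrixHolomorphicOn (matrixDslope f α) univ :=
  fun i k => (Complex.differentiableOn_dslope univ_mem).2 (hf i k)

theorem MatrixSmoothOn.matrixDslope {X : Type} [NormedAddCommGroup X] [NormedSpace ℝ X] {S : Set X}
    {F : X → ℂ → Matrix (Fin n) (Fin n) ℂ} (hS : IsOpen S) (α : ℂ)
    (hF : MatrixSmoothOn (fun p : X × ℂ => F p.1 p.2) (S ×ˢ univ))
    (hd : ∀ x ∈ S, MatrixHolomorphicOn (F x) univ) :
    MatrixSmoothOn (fun p : X × ℂ => matrixDslope (F p.1) α p.2) (S ×ˢ univ) :=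
  fun i k => ContDiffOn.dslope_prod hS α (hF i k)
    fun x hx => differentiableOn_univ.1 (hd x hx i k)

/-- By nilpotency the polynomial `det(1 + X M)` is a unit, hence constant; its values at `0` and `1`
agree. -/
theorem Matrix.det_one_add_of_mul_self_eq_zero {M : Matrix (Fin n) (Fin n) ℂ} (h : M * M = 0) :
    (1 + M).det = 1 := by
  have h₁ : IsUnit (-M).charpolyRev :=
    Matrix.isUnit_charpolyRev_of_isNilpotent ⟨2, by rw [pow_two, neg_mul_neg, h]⟩
  obtain ⟨r, -, hr⟩ := Polynomial.isUnit_iff.1 h₁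
  have h₂ : r = 1 := by
    rw [← Matrix.eval_charpolyRev (M := -M), ← hr, Polynomial.eval_C]
  have h₃ : (-M).charpolyRev.eval 1 = (1 + M).det := by
    rw [Matrix.charpolyRev, ← Polynomial.coe_evalRingHom, RingHom.map_det]
    congr 1
    ext i k
    simp [Matrix.one_apply, apply_ite]
  rw [← h₃, ← hr, h₂, Polynomial.eval_C]

end MatrixCalculus

/-! ### The dressed frame: invertibility and differential equation along one real parameter. -/

section Dressing

open Set Filter Topology Matrix

variable {n : ℕ}

/-- The holomorphic extension over `α` of `(1 + (z - α)⁻¹ N) f(z) (1 - (z - α)⁻¹ M)`, where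
`M` is the second argument. -/
noncomputable def dressedFrame (N N' : Matrix (Fin n) (Fin n) ℂ)
    (f : ℂ → Matrix (Fin n) (Fin n) ℂ) (α z : ℂ) : Matrix (Fin n) (Fin n) ℂ :=
  f z + N * matrixDslope f α z - matrixDslope f α z * N' -
    N * matrixDslope (matrixDslope f α) α z * N'

theorem MatrixHolomorphicOn.dressedFrame {f : ℂ → Matrix (Fin n) (Fin n) ℂ}
    (hf : MatrixHolomorphicOn f univ) (N N' : Matrix (Fin n) (Fin n) ℂ) (α : ℂ) :
    MatrixHolomorphicOn (dressedFrame N N' f α) univ := fun i k z _ => by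
  have h₁ := (hf.matrixDslope α).matrixHasDerivAt z
  have h₂ := ((hf.matrixDslope α).matrixDslope α).matrixHasDerivAt z
  exact (((((hf.matrixHasDerivAt z).add (h₁.const_mul N)).sub (h₁.mul_const N')).sub
    ((h₂.const_mul N).mul_const N')) i k).differentiableAt.differentiableWithinAt

theorem dressedFrame_of_ne {N N' : Matrix (Fin n) (Fin n) ℂ} {f : ℂ → Matrix (Fin n) (Fin n) ℂ}
    {α z : ℂ} (hN : N * N = 0) (h : (f α + N * matrixDeriv f α) * N' = N * f α) (hz : z ≠ α) :
    dressedFrame N N' f α z =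
      (1 + (1 / (z - α)) • N) * f z * (1 - (1 / (z - α)) • N') :=
  frame_identity hN h (smul_sub_eq_matrixDslope f hz)
    (by rw [← matrixDslope_same, smul_sub_eq_matrixDslope _ hz])

theorem MatrixHolomorphicOn.continuous_apply {f : ℂ → Matrix (Fin n) (Fin n) ℂ}
    (hf : MatrixHolomorphicOn f univ) (i k : Fin n) : Continuous fun z => f z i k :=
  continuousOn_univ.1 (hf i k).continuousOn

theorem MatrixHolomorphicOn.continuous_det {f : ℂ → Matrix (Fin n) (Fin n) ℂ}
    (hf : MatrixHolomorphicOn f univ) : Continuous fun z => (f z).det := by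
  simp only [Matrix.det_apply']
  exact continuous_finsetSum _ fun σ _ => continuous_const.mul
    (continuous_finsetProd _ fun i _ => hf.continuous_apply _ _)

theorem smul_mul_smul_self_eq_zero {N : Matrix (Fin n) (Fin n) ℂ} (hN : N * N = 0) (c : ℂ) :
    (c • N) * (c • N) = 0 := by
  rw [smul_mul_smul_comm, hN, smul_zero]

/-- Away from `α` the two outer factors have determinant `1`; continuity covers `α`, where
invertibility is not visible from the product. -/
theorem det_dressedFrame {N N' : Matrix (Fin n) (Fin n) ℂ} {f : ℂ → Matrix (Fin n) (Fin n) ℂ}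
    {α : ℂ} (hf : MatrixHolomorphicOn f univ) (hN : N * N = 0) (hN' : N' * N' = 0)
    (h : (f α + N * matrixDeriv f α) * N' = N * f α) (z : ℂ) :
    (dressedFrame N N' f α z).det = (f z).det := by
  refine congrFun (Continuous.ext_on (dense_compl_singleton α)
    (hf.dressedFrame N N' α).continuous_det hf.continuous_det fun w hw => ?_) z
  rw [dressedFrame_of_ne hN h hw, det_mul, det_mul,
    det_one_add_of_mul_self_eq_zero (smul_mul_smul_self_eq_zero hN _), sub_eq_add_neg, ← neg_smul,
    det_one_add_of_mul_self_eq_zero (smul_mul_smul_self_eq_zero hN' _), one_mul, mul_one]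

section Family

variable {e : ℝ → ℂ → Matrix (Fin n) (Fin n) ℂ} {s₀ : ℝ} {α : ℂ}
  {N : Matrix (Fin n) (Fin n) ℂ} {N' : ℝ → Matrix (Fin n) (Fin n) ℂ}
  {B : ℂ → Matrix (Fin n) (Fin n) ℂ}

/-- The equation `e_s = e B` differentiated in `λ` at `α`, with the two derivatives interchanged. -/
theorem matrixHasDerivAt_matrixDeriv
    (he : ∀ i k z, ContDiffAt ℝ ∞ (fun p : ℝ × ℂ => e p.1 p.2 i k) (s₀, z))
    (hhol : ∀ᶠ s in 𝓝 s₀, MatrixHolomorphicOn (e s) univ)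
    (hd : ∀ z, MatrixHasDerivAt (fun s => e s z) (e s₀ z * B z) s₀)
    (hB : MatrixHolomorphicOn B univ) :
    MatrixHasDerivAt (fun s => matrixDeriv (e s) α)
      (matrixDeriv (e s₀) α * B α + e s₀ α * matrixDeriv B α) s₀ := fun i k =>
  ContDiffAt.hasDerivAt_partial_swap (f := fun s z => e s z i k)
    ((he i k α).of_le (WithTop.coe_le_coe.2 le_top))
    (Eventually.of_forall fun z => hd z i k)
    (hhol.mono fun _ hs => hs.matrixHasDerivAt α i k)
    ((hhol.self_of_nhds.matrixHasDerivAt α).mul (hB.matrixHasDerivAt α) i k)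

/-- The Riccati equation: differentiate `hrel` in `s`, use `hrel` again to replace `N e(α)`, and
cancel the invertible factor. -/
theorem matrixDeriv_dressedN
    (he : ∀ i k z, ContDiffAt ℝ ∞ (fun p : ℝ × ℂ => e p.1 p.2 i k) (s₀, z))
    (hhol : ∀ᶠ s in 𝓝 s₀, MatrixHolomorphicOn (e s) univ)
    (hd : ∀ z, MatrixHasDerivAt (fun s => e s z) (e s₀ z * B z) s₀)
    (hB : MatrixHolomorphicOn B univ)
    (hrel : ∀ᶠ s in 𝓝 s₀, (e s α + N * matrixDeriv (e s) α) * N' s = N * e s α)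
    (hunit : IsUnit (e s₀ α + N * matrixDeriv (e s₀) α))
    (hN' : MatrixHasDerivAt N' (matrixDeriv N' s₀) s₀) :
    matrixDeriv N' s₀ = N' s₀ * B α - B α * N' s₀ - N' s₀ * matrixDeriv B α * N' s₀ := by
  have h₁ := ((hd α).add ((matrixHasDerivAt_matrixDeriv he hhol hd hB (α := α)).const_mul N)).mul hN'
  have h₂ := (h₁.congr_of_eventuallyEq (g := fun s => N * e s α)
    (hrel.mono fun s hs => hs.symm)).unique ((hd α).const_mul N)
  refine hunit.mul_left_cancel ?_
  have h₃ := hrel.self_of_nhds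
  have h₄ : N * (e s₀ α * B α) = (e s₀ α + N * matrixDeriv (e s₀) α) * N' s₀ * B α := by
    rw [h₃, mul_assoc]
  have h₅ : N * (e s₀ α * matrixDeriv B α) * N' s₀ =
      (e s₀ α + N * matrixDeriv (e s₀) α) * N' s₀ * matrixDeriv B α * N' s₀ := by
    rw [h₃]; simp only [mul_assoc]
  rw [h₄] at h₂
  have h₆ := eq_sub_of_add_eq' h₂
  rw [h₆, mul_sub, mul_sub, ← mul_assoc, ← mul_assoc, ← mul_assoc, ← mul_assoc, ← h₅]
  simp only [add_mul, mul_add, mul_assoc]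
  abel

theorem continuous_deriv_left {f : ℝ → ℂ → ℂ} {s₀ : ℝ}
    (hf : ∀ z, ContDiffAt ℝ ∞ (fun p : ℝ × ℂ => f p.1 p.2) (s₀, z)) :
    (∀ z, HasDerivAt (fun s => f s z) (deriv (fun s => f s z) s₀) s₀) ∧
      Continuous fun z => deriv (fun s => f s z) s₀ := by
  have h₁ : ∀ z, HasDerivAt (fun s => f s z)
      (fderiv ℝ (fun p : ℝ × ℂ => f p.1 p.2) (s₀, z) (1, 0)) s₀ := fun z => by
    have h := HasFDerivAt.comp (f := fun s => (s, z)) s₀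
      ((hf z).differentiableAt (by simp)).hasFDerivAt (hasFDerivAt_prodMk_left s₀ z)
    have h' := h.hasDerivAt
    simp only [ContinuousLinearMap.comp_apply, ContinuousLinearMap.inl_apply] at h'
    exact h'
  refine ⟨fun z => (h₁ z).differentiableAt.hasDerivAt, continuous_iff_continuousAt.2 fun z => ?_⟩
  simp only [(h₁ _).deriv]
  have h₂ : ContinuousAt (fderiv ℝ fun p : ℝ × ℂ => f p.1 p.2) (s₀, z) :=
    ((hf z).fderiv_right (m := 0) (by simp)).continuousAt
  exact (ContinuousAt.comp (f := fun z : ℂ => (s₀, z)) h₂ (by fun_prop)).clm_apply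
    continuousAt_const

/-- For `z ≠ α` the frame is an explicit product, and the Riccati equation with `gauge_identity`
gives the derivative. Both sides are continuous in `z`, so the formula persists at `α`. -/
theorem matrixHasDerivAt_dressedFrame (hN : N * N = 0) (hN₀ : N' s₀ * N' s₀ = 0)
    (he : ∀ i k z, ContDiffAt ℝ ∞ (fun p : ℝ × ℂ => e p.1 p.2 i k) (s₀, z))
    (hhol : ∀ᶠ s in 𝓝 s₀, MatrixHolomorphicOn (e s) univ)
    (hd : ∀ z, MatrixHasDerivAt (fun s => e s z) (e s₀ z * B z) s₀)
    (hB : MatrixHolomorphicOn B univ)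
    (hrel : ∀ᶠ s in 𝓝 s₀, (e s α + N * matrixDeriv (e s) α) * N' s = N * e s α)
    (hunit : IsUnit (e s₀ α + N * matrixDeriv (e s₀) α))
    (hN' : MatrixHasDerivAt N' (matrixDeriv N' s₀) s₀)
    (hfr : ∀ i k z, ContDiffAt ℝ ∞
      (fun p : ℝ × ℂ => dressedFrame N (N' p.1) (e p.1) α p.2 i k) (s₀, z)) (z : ℂ) :
    MatrixHasDerivAt (fun s => dressedFrame N (N' s) (e s) α z)
      (dressedFrame N (N' s₀) (e s₀) α z * dressedFrame (N' s₀) (N' s₀) B α z) s₀ := by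
  have hne : ∀ w ≠ α, MatrixHasDerivAt (fun s => dressedFrame N (N' s) (e s) α w)
      (dressedFrame N (N' s₀) (e s₀) α w * dressedFrame (N' s₀) (N' s₀) B α w) s₀ := by
    intro w hw
    set c : ℂ := 1 / (w - α) with hc
    have h₁ : MatrixHasDerivAt
        (fun s => (1 + c • N) * e s w * (1 - c • N' s))
        ((1 + c • N) * (e s₀ w * B w) * (1 - c • N' s₀) +
          (1 + c • N) * e s₀ w * (0 - c • matrixDeriv N' s₀)) s₀ :=
      ((hd w).const_mul _).mul ((MatrixHasDerivAt.const 1).sub (hN'.const_smul c))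
    refine (h₁.congr_of_eventuallyEq
      (hrel.mono fun s hs => dressedFrame_of_ne hN hs hw)).congr_deriv ?_
    have h₂ := gauge_identity (N := N' s₀) hN₀ (smul_sub_eq_matrixDslope B hw)
      (B₁ := matrixDeriv B α) (Bpp := matrixDslope (matrixDslope B α) α w)
      (by rw [← matrixDslope_same, smul_sub_eq_matrixDslope _ hw])
    rw [dressedFrame_of_ne hN hrel.self_of_nhds hw, dressedFrame, mul_assoc _ (1 - _), ← h₂,
      matrixDeriv_dressedN he hhol hd hB hrel hunit hN']
    simp only [mul_sub, mul_assoc, mul_one, zero_sub, mul_neg]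
    abel
  intro i k
  obtain ⟨h₁, h₂⟩ := continuous_deriv_left (f := fun s w => dressedFrame N (N' s) (e s) α w i k)
    (hfr i k)
  have h₃ : (fun w => deriv (fun s => dressedFrame N (N' s) (e s) α w i k) s₀) =
      fun w => (dressedFrame N (N' s₀) (e s₀) α w *
        dressedFrame (N' s₀) (N' s₀) B α w) i k := by
    refine Continuous.ext_on (dense_compl_singleton α) h₂ ?_ fun w hw => (hne w hw i k).deriv
    simp only [Matrix.mul_apply]
    exact continuous_finsetSum _ fun l _ =>
      ((hhol.self_of_nhds.dressedFrame _ _ _).continuous_apply _ _).mul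
        ((hB.dressedFrame _ _ _).continuous_apply _ _)
  exact (h₁ z).congr_deriv (congrFun h₃ z)

end Family

theorem matrixHolomorphicOn_geomShift (q : ℕ → Matrix (Fin n) (Fin n) ℂ) (k : ℕ) :
    MatrixHolomorphicOn (fun z => geomShift z q k) univ := fun i l z _ =>
  (MatrixHasDerivAt.geomShift_param q z k i l).differentiableAt.differentiableWithinAt

theorem matrixDslope_geomShift (q : ℕ → Matrix (Fin n) (Fin n) ℂ) (α : ℂ) (k : ℕ) :
    matrixDslope (fun z => geomShift z q k) α = fun z => geomShift z (geomShift α q) k := by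
  funext z
  rcases eq_or_ne z α with rfl | hz
  · rw [matrixDslope_same, (MatrixHasDerivAt.geomShift_param q z k).matrixDeriv_eq]
  · rw [← smul_sub_eq_matrixDslope _ hz, ← sub_smul_geomShift_geomShift, smul_smul,
      one_div_mul_cancel (sub_ne_zero.2 hz), one_smul]

theorem dressedFrame_geomShift (M : Matrix (Fin n) (Fin n) ℂ)
    (q : ℕ → Matrix (Fin n) (Fin n) ℂ) (α z : ℂ) (k : ℕ) :
    dressedFrame M M (fun z => geomShift z q k) α z = geomShift z (dressedSeq α M q) k := by
  rw [dressedFrame, matrixDslope_geomShift, matrixDslope_geomShift, geomShift_dressedSeq]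

/-- This puts the `x`-equation under the same lemmas as the `t`-equation. Index `2` sees only the
entries `a, v`; the later ones are irrelevant. -/
theorem smul_add_eq_geomShift (a v : Matrix (Fin n) (Fin n) ℂ) (z : ℂ) :
    z • a + v = geomShift z (fun k => if k = 0 then a else v) 2 := by
  simp [geomShift_succ]

theorem matrixHolomorphicOn_smul_add (a v : Matrix (Fin n) (Fin n) ℂ) :
    MatrixHolomorphicOn (fun z : ℂ => z • a + v) univ := by
  simp only [smul_add_eq_geomShift]
  exact matrixHolomorphicOn_geomShift _ _

theorem matrixDeriv_smul_add (a v : Matrix (Fin n) (Fin n) ℂ) (α : ℂ) :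
    matrixDeriv (fun z : ℂ => z • a + v) α = a := by
  simp only [smul_add_eq_geomShift]
  rw [(MatrixHasDerivAt.geomShift_param _ α 2).matrixDeriv_eq]
  simp [geomShift_succ]

theorem dressedFrame_smul_add (M a v : Matrix (Fin n) (Fin n) ℂ) (α z : ℂ) :
    dressedFrame M M (fun z => z • a + v) α z = z • a + (v - ⁅a, M⁆) := by
  simp only [smul_add_eq_geomShift]
  rw [dressedFrame_geomShift]
  simp [geomShift_succ, dressedSeq, Ring.lie_def]
  abel

/-- Since `N² = 0`, `N (1 + N X) = N`, hence `N (1 + N X)⁻¹ = N`; this makes the square vanish. -/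
theorem dressedN_relations {N X F : Matrix (Fin n) (Fin n) ℂ} (hN : N * N = 0)
    (hF : IsUnit F) (hP : IsUnit (1 + N * X)) :
    (1 + N * X) * F * (F⁻¹ * (1 + N * X)⁻¹ * N * F) = N * F ∧
      (F⁻¹ * (1 + N * X)⁻¹ * N * F) * (F⁻¹ * (1 + N * X)⁻¹ * N * F) = 0 := by
  have hF' : F * F⁻¹ = 1 := mul_nonsing_inv _ ((isUnit_iff_isUnit_det _).1 hF)
  have hP' : (1 + N * X) * (1 + N * X)⁻¹ = 1 := mul_nonsing_inv _ ((isUnit_iff_isUnit_det _).1 hP)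
  have h₁ : N * (1 + N * X)⁻¹ = N := by
    have : N * (1 + N * X) = N := by rw [mul_add, ← mul_assoc, hN]; simp
    calc N * (1 + N * X)⁻¹ = N * (1 + N * X) * (1 + N * X)⁻¹ := by rw [this]
      _ = N := by rw [mul_assoc, hP', mul_one]
  constructor
  · simp only [mul_assoc]
    rw [← mul_assoc F, hF', one_mul, ← mul_assoc _ _⁻¹, hP', one_mul]
  · simp only [mul_assoc]
    rw [← mul_assoc F, hF', one_mul, ← mul_assoc N _⁻¹, h₁, ← mul_assoc N N, hN]
    simp

end Dressing

/-! ### Dressing in the variables `x`, `t`: smoothness, the two linear equations, the new AKNS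
family. -/

section DressedSolution

open Set Filter Topology Matrix

variable {n j : ℕ} {a b : Matrix (Fin n) (Fin n) ℂ} {U : Set (ℝ × ℝ)}
  {u : ℝ → ℝ → Matrix (Fin n) (Fin n) ℂ} {Q : ℕ → ℝ → ℝ → Matrix (Fin n) (Fin n) ℂ}
  {E : ℝ → ℝ → ℂ → Matrix (Fin n) (Fin n) ℂ} {α : ℂ} {N : Matrix (Fin n) (Fin n) ℂ}

theorem eventually_mem_left {S : Set (ℝ × ℝ)} (hS : IsOpen S) {x t : ℝ} (h : (x, t) ∈ S) :
    ∀ᶠ y in 𝓝 x, (y, t) ∈ S :=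
  (show Continuous fun y : ℝ => (y, t) by fun_prop).continuousAt.eventually_mem (hS.mem_nhds h)

theorem eventually_mem_right {S : Set (ℝ × ℝ)} (hS : IsOpen S) {x t : ℝ} (h : (x, t) ∈ S) :
    ∀ᶠ s in 𝓝 t, (x, s) ∈ S :=
  (show Continuous fun s : ℝ => (x, s) by fun_prop).continuousAt.eventually_mem (hS.mem_nhds h)

namespace MatrixSmoothOn

variable {S : Set (ℝ × ℝ)} {f : ℝ → ℝ → Matrix (Fin n) (Fin n) ℂ}

theorem hasDeriv_left (hf : MatrixSmoothOn (fun p : ℝ × ℝ => f p.1 p.2) S) (hS : IsOpen S)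
    {x t : ℝ} (h : (x, t) ∈ S) :
    MatrixHasDerivAt (fun y => f y t) (matrixDeriv (fun y => f y t) x) x :=
  (hf.comp (φ := fun y : ℝ => (y, t)) (T := {y | (y, t) ∈ S}) (by fun_prop)
    fun _ hy => hy).matrixHasDerivAt (eventually_mem_left hS h)

theorem hasDeriv_right (hf : MatrixSmoothOn (fun p : ℝ × ℝ => f p.1 p.2) S) (hS : IsOpen S)
    {x t : ℝ} (h : (x, t) ∈ S) :
    MatrixHasDerivAt (fun s => f x s) (matrixDeriv (fun s => f x s) t) t :=
  (hf.comp (φ := fun s : ℝ => (x, s)) (T := {s | (x, s) ∈ S}) (by fun_prop)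
    fun _ hs => hs).matrixHasDerivAt (eventually_mem_right hS h)

theorem contDiffAt_left {F : ℝ → ℝ → ℂ → Matrix (Fin n) (Fin n) ℂ}
    (hF : MatrixSmoothOn (fun p : (ℝ × ℝ) × ℂ => F p.1.1 p.1.2 p.2) (S ×ˢ univ)) (hS : IsOpen S)
    {x t : ℝ} (h : (x, t) ∈ S) (i k : Fin n) (z : ℂ) :
    ContDiffAt ℝ ∞ (fun p : ℝ × ℂ => F p.1 t p.2 i k) (x, z) :=
  ContDiffAt.comp (f := fun p : ℝ × ℂ => ((p.1, t), p.2)) (x, z)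
    ((hF i k).contDiffAt ((hS.prod isOpen_univ).mem_nhds ⟨h, mem_univ z⟩))
    (ContDiff.contDiffAt (by fun_prop))

theorem contDiffAt_right {F : ℝ → ℝ → ℂ → Matrix (Fin n) (Fin n) ℂ}
    (hF : MatrixSmoothOn (fun p : (ℝ × ℝ) × ℂ => F p.1.1 p.1.2 p.2) (S ×ˢ univ)) (hS : IsOpen S)
    {x t : ℝ} (h : (x, t) ∈ S) (i k : Fin n) (z : ℂ) :
    ContDiffAt ℝ ∞ (fun p : ℝ × ℂ => F x p.1 p.2 i k) (t, z) :=
  ContDiffAt.comp (f := fun p : ℝ × ℂ => ((x, p.1), p.2)) (t, z)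
    ((hF i k).contDiffAt ((hS.prod isOpen_univ).mem_nhds ⟨h, mem_univ z⟩))
    (ContDiff.contDiffAt (by fun_prop))

end MatrixSmoothOn

theorem mul_eq_of_inv_mul_eq {F D A : Matrix (Fin n) (Fin n) ℂ} (hF : IsUnit F)
    (h : F⁻¹ * D = A) : D = F * A := by
  rw [← h, mul_nonsing_inv_cancel_left _ _ ((isUnit_iff_isUnit_det _).1 hF)]

namespace IsTrivialization

theorem hasDeriv_x (hE : IsTrivialization a b j U u Q E) (hU : IsOpen U) {x t : ℝ}
    (h : (x, t) ∈ U) (z : ℂ) :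
    MatrixHasDerivAt (fun y => E y t z) (E x t z * (z • a + u x t)) x := by
  have h₁ : MatrixHasDerivAt (fun y => E y t z) (matrixDeriv (fun y => E y t z) x) x := fun i k =>
    ((continuous_deriv_left (f := fun y w => E y t w i k)
      (hE.smooth.contDiffAt_left hU h i k)).1 z)
  exact h₁.congr_deriv (mul_eq_of_inv_mul_eq ((hE.positive x t h).2 z) (hE.x_eq x t h z))

theorem hasDeriv_t (hE : IsTrivialization a b j U u Q E) (hU : IsOpen U)
    (hQ : ∀ x t, (x, t) ∈ U → Q 0 x t = b) {x t : ℝ} (h : (x, t) ∈ U) (z : ℂ) :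
    MatrixHasDerivAt (fun s => E x s z)
      (E x t z * geomShift z (fun k => Q k x t) (j + 1)) t := by
  have h₁ : MatrixHasDerivAt (fun s => E x s z) (matrixDeriv (fun s => E x s z) t) t := fun i k =>
    ((continuous_deriv_left (f := fun s w => E x s w i k)
      (hE.smooth.contDiffAt_right hU h i k)).1 z)
  refine h₁.congr_deriv (mul_eq_of_inv_mul_eq ((hE.positive x t h).2 z) ?_)
  rw [hE.t_eq x t h z, geomShift_succ_eq_sum, hQ x t h]

theorem dressingE₁_eq (hE : IsTrivialization a b j U u Q E) {x t : ℝ} (h : (x, t) ∈ U) :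
    dressingE₁ E α x t = matrixDeriv (E x t) α * (E x t α)⁻¹ :=
  (((hE.positive x t h).1.matrixHasDerivAt α).mul_const _).matrixDeriv_eq

/-- This removes the inverse hidden in `dressingE₁` and links the domain condition to the pole
cancellation. -/
theorem one_add_mul_dressingE₁_mul (hE : IsTrivialization a b j U u Q E) {x t : ℝ}
    (h : (x, t) ∈ U) :
    (1 + N * dressingE₁ E α x t) * E x t α = E x t α + N * matrixDeriv (E x t) α := by
  rw [hE.dressingE₁_eq h, add_mul, one_mul, mul_assoc, mul_assoc,
    nonsing_inv_mul _ ((isUnit_iff_isUnit_det _).1 ((hE.positive x t h).2 α)), mul_one]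

theorem dressedN_relation (hE : IsTrivialization a b j U u Q E) (hN : N * N = 0) {x t : ℝ}
    (h : (x, t) ∈ dressedDomain U E α N) :
    (E x t α + N * matrixDeriv (E x t) α) * dressedN E α N x t = N * E x t α := by
  rw [← hE.one_add_mul_dressingE₁_mul h.1]
  exact (dressedN_relations hN ((hE.positive x t h.1).2 α) h.2).1

theorem dressedN_mul_self (hE : IsTrivialization a b j U u Q E) (hN : N * N = 0) {x t : ℝ}
    (h : (x, t) ∈ dressedDomain U E α N) : dressedN E α N x t * dressedN E α N x t = 0 :=
  (dressedN_relations hN ((hE.positive x t h.1).2 α) h.2).2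

theorem isUnit_dressing (hE : IsTrivialization a b j U u Q E) {x t : ℝ}
    (h : (x, t) ∈ dressedDomain U E α N) : IsUnit (E x t α + N * matrixDeriv (E x t) α) := by
  rw [← hE.one_add_mul_dressingE₁_mul h.1]
  exact h.2.mul ((hE.positive x t h.1).2 α)

theorem smooth_matrixDslope (hE : IsTrivialization a b j U u Q E) (hU : IsOpen U) (α : ℂ) :
    MatrixSmoothOn (fun p : (ℝ × ℝ) × ℂ => matrixDslope (E p.1.1 p.1.2) α p.2) (U ×ˢ univ) :=
  MatrixSmoothOn.matrixDslope (F := fun p : ℝ × ℝ => E p.1 p.2) hU α hE.smooth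
    fun p hp => (hE.positive p.1 p.2 hp).1

theorem smooth_apply (hE : IsTrivialization a b j U u Q E) (α : ℂ) :
    MatrixSmoothOn (fun p : ℝ × ℝ => E p.1 p.2 α) U :=
  hE.smooth.comp (φ := fun p : ℝ × ℝ => (p, α)) (by fun_prop) fun _ hp => ⟨hp, mem_univ _⟩

theorem smooth_dressing (hE : IsTrivialization a b j U u Q E) (hU : IsOpen U) :
    MatrixSmoothOn (fun p : ℝ × ℝ => 1 + N * dressingE₁ E α p.1 p.2) U := by
  refine (MatrixSmoothOn.const 1).add ((MatrixSmoothOn.const N).mul ?_)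
  have h : MatrixSmoothOn (fun p : ℝ × ℝ => matrixDslope (E p.1 p.2) α α * (E p.1 p.2 α)⁻¹) U :=
    ((hE.smooth_matrixDslope hU α).comp (φ := fun p : ℝ × ℝ => (p, α)) (by fun_prop)
      fun _ hp => ⟨hp, mem_univ _⟩).mul
      ((hE.smooth_apply α).inv fun p hp => (hE.positive p.1 p.2 hp).2 α)
  exact h.congr fun p hp => by rw [hE.dressingE₁_eq hp, matrixDslope_same]

theorem isOpen_dressedDomain (hE : IsTrivialization a b j U u Q E) (hU : IsOpen U) :
    IsOpen (dressedDomain U E α N) := by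
  have h : IsOpen (U ∩ (fun p : ℝ × ℝ => (1 + N * dressingE₁ E α p.1 p.2).det) ⁻¹' {0}ᶜ) :=
    (hE.smooth_dressing hU).det.continuousOn.isOpen_inter_preimage hU isOpen_compl_singleton
  convert h using 1
  ext p
  simp [dressedDomain, isUnit_iff_isUnit_det]

theorem smooth_dressedN (hE : IsTrivialization a b j U u Q E) (hU : IsOpen U) :
    MatrixSmoothOn (fun p : ℝ × ℝ => dressedN E α N p.1 p.2) (dressedDomain U E α N) := by
  have hV : dressedDomain U E α N ⊆ U := fun p hp => hp.1
  have h₁ := (hE.smooth_apply α).mono hV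
  exact (((h₁.inv fun p hp => (hE.positive p.1 p.2 hp.1).2 α).mul
    (((hE.smooth_dressing hU).mono hV).inv fun p hp => hp.2)).mul (MatrixSmoothOn.const N)).mul h₁

theorem smooth_dressedFrame (hE : IsTrivialization a b j U u Q E) (hU : IsOpen U) :
    MatrixSmoothOn (fun p : (ℝ × ℝ) × ℂ =>
      dressedFrame N (dressedN E α N p.1.1 p.1.2) (E p.1.1 p.1.2) α p.2)
      (dressedDomain U E α N ×ˢ univ) := by
  have hV : (dressedDomain U E α N ×ˢ univ : Set ((ℝ × ℝ) × ℂ)) ⊆ U ×ˢ univ :=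
    prod_mono (fun p hp => hp.1) subset_rfl
  have h₁ := hE.smooth_matrixDslope hU α
  have h₂ : MatrixSmoothOn (fun p : (ℝ × ℝ) × ℂ =>
      matrixDslope (matrixDslope (E p.1.1 p.1.2) α) α p.2) (U ×ˢ univ) :=
    MatrixSmoothOn.matrixDslope (F := fun p : ℝ × ℝ => matrixDslope (E p.1 p.2) α) hU α h₁
      fun p hp => (hE.positive p.1 p.2 hp).1.matrixDslope α
  have h₃ : MatrixSmoothOn (fun p : (ℝ × ℝ) × ℂ => dressedN E α N p.1.1 p.1.2)
      (dressedDomain U E α N ×ˢ univ) :=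
    (hE.smooth_dressedN hU).comp (φ := Prod.fst) contDiff_fst fun p hp => hp.1
  exact (((hE.smooth.mono hV).add ((MatrixSmoothOn.const N).mul (h₁.mono hV))).sub
    ((h₁.mono hV).mul h₃)).sub (((MatrixSmoothOn.const N).mul (h₂.mono hV)).mul h₃)

/-- The Riccati equation for `B = aλ + u`, needed for the recursion of the dressed coefficients. -/
theorem hasDeriv_x_dressedN (hE : IsTrivialization a b j U u Q E) (hU : IsOpen U)
    (hN : N * N = 0) {x t : ℝ} (h : (x, t) ∈ dressedDomain U E α N) :
    MatrixHasDerivAt (fun y => dressedN E α N y t)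
      (dressedN E α N x t * (α • a + u x t) - (α • a + u x t) * dressedN E α N x t -
        dressedN E α N x t * a * dressedN E α N x t) x := by
  have hV := hE.isOpen_dressedDomain hU (α := α) (N := N)
  have hev := eventually_mem_left hV h
  have h₁ := (hE.smooth_dressedN hU).hasDeriv_left hV h
  refine h₁.congr_deriv ?_
  have h₂ := matrixDeriv_dressedN (α := α) (N := N) (e := fun y => E y t)
    (N' := fun y => dressedN E α N y t)
    (B := fun z => z • a + u x t) (hE.smooth.contDiffAt_left hU h.1)
    (hev.mono fun y hy => (hE.positive y t hy.1).1) (hE.hasDeriv_x hU h.1)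
    (matrixHolomorphicOn_smul_add a (u x t))
    (hev.mono fun y hy => hE.dressedN_relation hN hy) (hE.isUnit_dressing h) h₁
  rw [h₂, matrixDeriv_smul_add]

theorem hasDeriv_x_dressedFrame (hE : IsTrivialization a b j U u Q E) (hU : IsOpen U)
    (hN : N * N = 0) {x t : ℝ} (h : (x, t) ∈ dressedDomain U E α N) (z : ℂ) :
    MatrixHasDerivAt (fun y => dressedFrame N (dressedN E α N y t) (E y t) α z)
      (dressedFrame N (dressedN E α N x t) (E x t) α z *
        (z • a + (u x t - ⁅a, dressedN E α N x t⁆))) x := by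
  have hV := hE.isOpen_dressedDomain hU (α := α) (N := N)
  have hev := eventually_mem_left hV h
  have h₂ := matrixHasDerivAt_dressedFrame (α := α) (N := N) (e := fun y => E y t)
    (N' := fun y => dressedN E α N y t)
    (B := fun z => z • a + u x t) hN (hE.dressedN_mul_self hN h)
    (hE.smooth.contDiffAt_left hU h.1)
    (hev.mono fun y hy => (hE.positive y t hy.1).1) (hE.hasDeriv_x hU h.1)
    (matrixHolomorphicOn_smul_add a (u x t))
    (hev.mono fun y hy => hE.dressedN_relation hN hy) (hE.isUnit_dressing h)
    ((hE.smooth_dressedN hU).hasDeriv_left hV h)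
    ((hE.smooth_dressedFrame hU).contDiffAt_left
      (F := fun x t z => dressedFrame N (dressedN E α N x t) (E x t) α z) hV h) z
  rwa [dressedFrame_smul_add] at h₂

theorem hasDeriv_t_dressedFrame (hE : IsTrivialization a b j U u Q E) (hU : IsOpen U)
    (hQ : ∀ x t, (x, t) ∈ U → Q 0 x t = b)
    (hN : N * N = 0) {x t : ℝ} (h : (x, t) ∈ dressedDomain U E α N) (z : ℂ) :
    MatrixHasDerivAt (fun s => dressedFrame N (dressedN E α N x s) (E x s) α z)
      (dressedFrame N (dressedN E α N x t) (E x t) α z *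
        geomShift z (dressedSeq α (dressedN E α N x t) fun k => Q k x t) (j + 1)) t := by
  have hV := hE.isOpen_dressedDomain hU (α := α) (N := N)
  have hev := eventually_mem_right hV h
  have h₂ := matrixHasDerivAt_dressedFrame (α := α) (N := N) (e := fun s => E x s)
    (N' := fun s => dressedN E α N x s)
    (B := fun z => geomShift z (fun k => Q k x t) (j + 1)) hN (hE.dressedN_mul_self hN h)
    (hE.smooth.contDiffAt_right hU h.1)
    (hev.mono fun s hs => (hE.positive x s hs.1).1) (hE.hasDeriv_t hU hQ h.1)
    (matrixHolomorphicOn_geomShift _ _)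
    (hev.mono fun s hs => hE.dressedN_relation hN hs) (hE.isUnit_dressing h)
    ((hE.smooth_dressedN hU).hasDeriv_right hV h)
    ((hE.smooth_dressedFrame hU).contDiffAt_right
      (F := fun x t z => dressedFrame N (dressedN E α N x t) (E x t) α z) hV h) z
  rwa [dressedFrame_geomShift] at h₂

end IsTrivialization

theorem nonsing_inv_mul_eq_of_eq_mul {F D A : Matrix (Fin n) (Fin n) ℂ} (hF : IsUnit F)
    (h : D = F * A) : F⁻¹ * D = A := by
  rw [h, nonsing_inv_mul_cancel_left _ _ ((isUnit_iff_isUnit_det _).1 hF)]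

theorem MatrixHasDerivAt.dressedSeq {𝕜 : Type*} [NontriviallyNormedField 𝕜] [NormedAlgebra 𝕜 ℂ]
    {M : 𝕜 → Matrix (Fin n) (Fin n) ℂ} {M' : Matrix (Fin n) (Fin n) ℂ}
    {q : 𝕜 → ℕ → Matrix (Fin n) (Fin n) ℂ} {q' : ℕ → Matrix (Fin n) (Fin n) ℂ} {x : 𝕜}
    (hM : MatrixHasDerivAt M M' x) (hq : ∀ k, MatrixHasDerivAt (fun y => q y k) (q' k) x)
    (k : ℕ) :
    MatrixHasDerivAt (fun y => _root_.dressedSeq α (M y) (q y) k)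
      (q' k + (M' * _root_.geomShift α (q x) k + M x * _root_.geomShift α q' k) -
        (_root_.geomShift α q' k * M x + _root_.geomShift α (q x) k * M') -
        ((M' * _root_.geomShift α (_root_.geomShift α (q x)) k +
          M x * _root_.geomShift α (_root_.geomShift α q') k) * M x +
          M x * _root_.geomShift α (_root_.geomShift α (q x)) k * M')) x := by
  have h₁ : ∀ k, MatrixHasDerivAt (fun y => _root_.geomShift α (q y) k)
    (_root_.geomShift α q' k) x := fun k => MatrixHasDerivAt.geomShift hq k
  have h₂ : MatrixHasDerivAt (fun y => _root_.geomShift α (_root_.geomShift α (q y)) k)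
    (_root_.geomShift α (_root_.geomShift α q') k) x := MatrixHasDerivAt.geomShift h₁ k
  exact (((hq k).add (hM.mul (h₁ k))).sub ((h₁ k).mul hM)).sub ((hM.mul h₂).mul hM)

/-- By invariance of the trace form, `tr(z[a, M]) = tr([z, a]M)`, which vanishes for `z` in the
centralizer. -/
theorem InCentralizerPerp.sub_lie {a y : Matrix (Fin n) (Fin n) ℂ} (h : InCentralizerPerp a y)
    (M : Matrix (Fin n) (Fin n) ℂ) : InCentralizerPerp a (y - ⁅a, M⁆) := by
  refine ⟨by rw [trace_sub, h.1, Ring.lie_def, trace_sub, trace_mul_comm]; simp,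
    fun z hz haz => ?_⟩
  rw [Ring.lie_def, sub_eq_zero] at haz
  rw [mul_sub, trace_sub, h.2 z hz (by rw [Ring.lie_def, haz, sub_self]), Ring.lie_def, mul_sub,
    trace_sub, ← mul_assoc, ← haz, mul_assoc, trace_mul_comm, mul_assoc]
  simp

theorem commutator_eq_zero_of_lie_eq_zero {a b : Matrix (Fin n) (Fin n) ℂ} (hab : ⁅a, b⁆ = 0) :
    b * a - a * b = 0 := by
  rw [← neg_sub, ← Ring.lie_def, hab, neg_zero]

/-- The dressed coefficients form an AKNS family for the dressed potential. -/
theorem IsAKNSFamily.dressed (hU : IsOpen U) (hQ : IsAKNSFamily a b U u Q)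
    (hE : IsTrivialization a b j U u Q E) (hab : ⁅a, b⁆ = 0) (hN : N * N = 0) :
    IsAKNSFamily a b (dressedDomain U E α N) (fun x t => u x t - ⁅a, dressedN E α N x t⁆)
      (fun k x t => dressedSeq α (dressedN E α N x t) (fun k => Q k x t) k) := by
  have hV := hE.isOpen_dressedDomain hU (α := α) (N := N)
  have hVU : dressedDomain U E α N ⊆ U := fun p hp => hp.1
  refine ⟨fun k => ?_, fun k x t h => ?_, fun x t h => ?_, fun k x t h => ?_, fun x t h => ?_⟩
  · have h₁ : ∀ k, MatrixSmoothOn (fun p : ℝ × ℝ => Q k p.1 p.2) (dressedDomain U E α N) :=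
      fun k => (hQ.smooth k).mono hVU
    have h₂ := MatrixSmoothOn.geomShift (α := α) (q := fun p : ℝ × ℝ => fun k => Q k p.1 p.2) h₁
    have h₃ := MatrixSmoothOn.geomShift (α := α) h₂
    have h₄ := hE.smooth_dressedN hU (α := α) (N := N)
    exact (((h₁ k).add (h₄.mul (h₂ k))).sub ((h₂ k).mul h₄)).sub ((h₄.mul (h₃ k)).mul h₄)
  · simp only [dressedSeq]
    -- By cyclicity the two linear terms cancel and the last one contains `Ñ² = 0`.
    rw [trace_sub, trace_sub, trace_add, hQ.trace_eq_zero k x t h.1,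
      trace_mul_comm (geomShift α _ k) (dressedN E α N x t), trace_mul_comm (_ * _),
      ← mul_assoc, hE.dressedN_mul_self hN h]
    simp
  · simp [dressedSeq, hQ.zero_eq x t h.1]
  · have hq : ∀ k, MatrixHasDerivAt (fun y => Q k y t)
        ((Q (k + 1) x t * a - a * Q (k + 1) x t) - (u x t * Q k x t - Q k x t * u x t)) x :=
      fun k => ((hQ.smooth k).hasDeriv_left hU h.1).congr_deriv (by
        rw [← Ring.lie_def, ← Ring.lie_def, ← hQ.recursion k x t h.1, add_sub_cancel_right])
    -- The dropped coefficient is `[b, a] = 0` here; for the second shift it is zero because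
    -- `geomShift` starts with `0`.
    have e₁ := geomShift_commutator (α := α) (u := u x t) (q := fun k => Q k x t)
      (a := a) (by rw [hQ.zero_eq x t h.1, commutator_eq_zero_of_lie_eq_zero hab])
    have e₂ := geomShift_commutator (α := α) (a := a) (u := u x t)
      (q := geomShift α fun k => Q k x t) (by simp)
    have h₁ := ((hE.hasDeriv_x_dressedN hU hN h).dressedSeq (α := α)
      (q := fun y k => Q k y t) hq k).matrixDeriv_eq
    rw [e₁, e₂] at h₁
    beta_reduce at h₁ ⊢
    rw [h₁]
    exact dressedSeq_recursion (hE.dressedN_mul_self hN h) (fun k => Q k x t) k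
  · exact dressedSeq_conjugate (hE.dressedN_mul_self hN h) (hQ.conjugate x t h.1)

end DressedSolution

/-! ### The dressed trivialization, flow and reduced wave function. -/

section Main

open Set Filter Topology Matrix

variable {n j : ℕ} {a b : Matrix (Fin n) (Fin n) ℂ} {U : Set (ℝ × ℝ)}
  {u : ℝ → ℝ → Matrix (Fin n) (Fin n) ℂ} {Q : ℕ → ℝ → ℝ → Matrix (Fin n) (Fin n) ℂ}
  {E w : ℝ → ℝ → ℂ → Matrix (Fin n) (Fin n) ℂ} {α : ℂ} {N : Matrix (Fin n) (Fin n) ℂ}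

namespace IsTrivialization

theorem matrixDeriv_eq_zero_of_initial (hE : IsTrivialization a b j U u Q E) :
    matrixDeriv (E 0 0) α = 0 := by
  rw [show E 0 0 = fun _ => 1 from funext hE.initial,
    (MatrixHasDerivAt.const (𝕜 := ℂ) 1).matrixDeriv_eq]

theorem zero_mem_dressedDomain (hE : IsTrivialization a b j U u Q E)
    (h₀ : ((0 : ℝ), (0 : ℝ)) ∈ U) : ((0 : ℝ), (0 : ℝ)) ∈ dressedDomain U E α N := by
  refine ⟨h₀, ?_⟩
  rw [hE.dressingE₁_eq h₀, hE.matrixDeriv_eq_zero_of_initial]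
  simp

theorem dressedN_zero (hE : IsTrivialization a b j U u Q E) (h₀ : ((0 : ℝ), (0 : ℝ)) ∈ U) :
    dressedN E α N 0 0 = N := by
  rw [dressedN, hE.dressingE₁_eq h₀, hE.matrixDeriv_eq_zero_of_initial, hE.initial]
  simp

theorem dressedFrame_zero (hE : IsTrivialization a b j U u Q E) (M : Matrix (Fin n) (Fin n) ℂ)
    (z : ℂ) : dressedFrame N M (E 0 0) α z = 1 := by
  have h₁ : ∀ c : Matrix (Fin n) (Fin n) ℂ, matrixDslope (fun _ => c) α = fun _ => 0 := fun c => by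
    ext z i k
    rcases eq_or_ne z α with rfl | hz
    · simp [matrixDslope, dslope_same]
    · simp [matrixDslope, dslope_of_ne _ hz, slope_def_field]
  rw [dressedFrame, show E 0 0 = fun _ => 1 from funext hE.initial, h₁, h₁]
  simp

theorem isPositiveLoop_dressedFrame (hE : IsTrivialization a b j U u Q E) (hN : N * N = 0)
    {x t : ℝ} (h : (x, t) ∈ dressedDomain U E α N) :
    IsPositiveLoop (dressedFrame N (dressedN E α N x t) (E x t) α) := by
  obtain ⟨h₁, h₂⟩ := hE.positive x t h.1
  refine ⟨h₁.dressedFrame _ _ _, fun z => ?_⟩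
  rw [isUnit_iff_isUnit_det, det_dressedFrame h₁ hN (hE.dressedN_mul_self hN h)
    (hE.dressedN_relation hN h), ← isUnit_iff_isUnit_det]
  exact h₂ z

theorem dressed (hE : IsTrivialization a b j U u Q E) (hU : IsOpen U)
    (hQ : ∀ x t, (x, t) ∈ U → Q 0 x t = b) (hN : N * N = 0) :
    IsTrivialization a b j (dressedDomain U E α N) (fun x t => u x t - ⁅a, dressedN E α N x t⁆)
      (fun k x t => dressedSeq α (dressedN E α N x t) (fun k => Q k x t) k)
      (fun x t => dressedFrame N (dressedN E α N x t) (E x t) α) where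
  smooth := hE.smooth_dressedFrame hU
  positive x t h := hE.isPositiveLoop_dressedFrame hN h
  x_eq x t h z := nonsing_inv_mul_eq_of_eq_mul ((hE.isPositiveLoop_dressedFrame hN h).2 z)
    (hE.hasDeriv_x_dressedFrame hU hN h z).matrixDeriv_eq
  t_eq x t h z := by
    rw [nonsing_inv_mul_eq_of_eq_mul ((hE.isPositiveLoop_dressedFrame hN h).2 z)
      (hE.hasDeriv_t_dressedFrame hU hQ hN h z).matrixDeriv_eq, geomShift_succ_eq_sum]
    congr 2
    simp [dressedSeq, hQ x t h.1]
  initial z := hE.dressedFrame_zero _ z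

/-- The flow equation is the compatibility of the two equations for a trivialization at `λ = 0`. -/
theorem flow_eq (hE : IsTrivialization a b j U u Q E) (hU : IsOpen U)
    (hu : MatrixSmoothOn (fun p : ℝ × ℝ => u p.1 p.2) U)
    (hQ : MatrixSmoothOn (fun p : ℝ × ℝ => Q j p.1 p.2) U)
    (hQ₀ : ∀ x t, (x, t) ∈ U → Q 0 x t = b) {x t : ℝ} (h : (x, t) ∈ U) :
    matrixDeriv (fun s => u x s) t = matrixDeriv (fun y => Q j y t) x + ⁅u x t, Q j x t⁆ := by
  have hx : ∀ {x t : ℝ}, (x, t) ∈ U →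
      MatrixHasDerivAt (fun y => E y t 0) (E x t 0 * u x t) x := fun h => by
    simpa using hE.hasDeriv_x hU h 0
  have ht : ∀ {x t : ℝ}, (x, t) ∈ U →
      MatrixHasDerivAt (fun s => E x s 0) (E x t 0 * Q j x t) t := fun h => by
    -- At `z = 0` only the last coefficient `Q j` survives.
    simpa [geomShift_succ] using hE.hasDeriv_t hU hQ₀ h 0
  have h₁ := (ht h).mul (hu.hasDeriv_right hU h)
  have h₂ := (hx h).mul (hQ.hasDeriv_left hU h)
  -- Equality of the mixed derivatives of `E(·, ·, 0)`: the `x`-derivative of `E_t = E Q_j` equals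
  -- the `t`-derivative of `E_x = E u`.
  have h₃ : MatrixHasDerivAt (fun y => E y t 0 * Q j y t)
      (E x t 0 * Q j x t * u x t + E x t 0 * matrixDeriv (fun s => u x s) t) x := fun i k =>
    ContDiffAt.hasDerivAt_partial_swap (f := fun y s => E y s 0 i k)
      ((((hE.smooth_apply 0) i k).contDiffAt (hU.mem_nhds h)).of_le (WithTop.coe_le_coe.2 le_top))
      ((eventually_mem_right hU h).mono fun s hs => hx hs i k)
      ((eventually_mem_left hU h).mono fun y hy => ht hy i k) (h₁ i k)
  have h₄ := h₃.unique h₂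
  refine ((hE.positive x t h).2 0).mul_left_cancel ?_
  rw [eq_sub_of_add_eq' h₄, Ring.lie_def]
  simp only [mul_add, mul_sub, mul_assoc]
  abel

end IsTrivialization

theorem nilpotentLoop_one (α : ℂ) (M : Matrix (Fin n) (Fin n) ℂ) (z : ℂ) :
    nilpotentLoop α 1 M z = 1 + (1 / (z - α)) • M := by
  rw [nilpotentLoop, pow_one]

theorem nilpotentLoop_mul_inv_cancel {M : Matrix (Fin n) (Fin n) ℂ} (hM : M * M = 0) (α z : ℂ) :
    nilpotentLoop α 1 M z * (1 - (1 / (z - α)) • M) = 1 := by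
  rw [nilpotentLoop_one, mul_sub, add_mul, add_mul, smul_mul_smul_self_eq_zero hM]
  simp

theorem nilpotentLoop_inv {M : Matrix (Fin n) (Fin n) ℂ} (hM : M * M = 0) (α z : ℂ) :
    (nilpotentLoop α 1 M z)⁻¹ = 1 - (1 / (z - α)) • M :=
  inv_eq_right_inv (nilpotentLoop_mul_inv_cancel hM α z)

theorem isUnit_nilpotentLoop {M : Matrix (Fin n) (Fin n) ℂ} (hM : M * M = 0) (α z : ℂ) :
    IsUnit (nilpotentLoop α 1 M z) :=
  IsUnit.of_mul_eq_one _ (nilpotentLoop_mul_inv_cancel hM α z)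

theorem IsTrivialization.dressedFrame_eq_nilpotentLoop (hE : IsTrivialization a b j U u Q E)
    (hN : N * N = 0) {x t : ℝ} (h : (x, t) ∈ dressedDomain U E α N) {z : ℂ} (hz : z ≠ α) :
    dressedFrame N (dressedN E α N x t) (E x t) α z =
      nilpotentLoop α 1 N z * E x t z * (nilpotentLoop α 1 (dressedN E α N x t) z)⁻¹ := by
  rw [dressedFrame_of_ne hN (hE.dressedN_relation hN h) hz, nilpotentLoop_one,
    nilpotentLoop_inv (hE.dressedN_mul_self hN h)]

theorem tendsto_one_sub_smul (M : Matrix (Fin n) (Fin n) ℂ) (α : ℂ) :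
    Tendsto (fun z : ℂ => 1 - (1 / (z - α)) • M) (Bornology.cobounded ℂ) (𝓝 1) := by
  have h₁ : Tendsto (fun z : ℂ => z - α) (Bornology.cobounded ℂ) (Bornology.cobounded ℂ) :=
    tendsto_sub_const_cobounded α
  have h₂ : Tendsto (fun z : ℂ => 1 / (z - α)) (Bornology.cobounded ℂ) (𝓝 0) := by
    simpa [Function.comp_def] using tendsto_inv₀_cobounded.comp h₁
  simpa using (tendsto_const_nhds (x := (1 : Matrix (Fin n) (Fin n) ℂ))).sub
    (h₂.smul_const M)

/-- Since `Ñ(0,0) = N`, the left factor `m_N ω(0,0)⁻¹` is the inverse of the new wave function at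
the origin. -/
theorem IsLocalReducedWaveFunction.dressed (hw : IsLocalReducedWaveFunction a b j U E w)
    (hE : IsTrivialization a b j U u Q E) (hU : IsOpen U) (h₀ : ((0 : ℝ), (0 : ℝ)) ∈ U)
    (hN : N * N = 0) :
    IsLocalReducedWaveFunction a b j (dressedDomain U E α N)
      (fun x t => dressedFrame N (dressedN E α N x t) (E x t) α)
      (fun x t z => w x t z * (nilpotentLoop α 1 (dressedN E α N x t) z)⁻¹) := by
  obtain ⟨R, hsm, hR⟩ := hw
  have hne : ∀ {z : ℂ}, max R ‖α‖ < ‖z‖ → z ≠ α := fun hz h => by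
    subst h; exact (lt_irrefl _ ((le_max_right _ _).trans_lt hz))
  have hlt : ∀ {z : ℂ}, max R ‖α‖ < ‖z‖ → R < ‖z‖ := fun hz => (le_max_left _ _).trans_lt hz
  have hinv : ∀ {x t : ℝ}, (x, t) ∈ dressedDomain U E α N → ∀ z,
      (nilpotentLoop α 1 (dressedN E α N x t) z)⁻¹ = 1 - (1 / (z - α)) • dressedN E α N x t :=
    fun h z => nilpotentLoop_inv (hE.dressedN_mul_self hN h) α z
  -- The larger radius keeps `λ` away from the pole `α`.
  refine ⟨max R ‖α‖, ?_, fun x t h => ⟨?_, ?_, fun z hz => ⟨?_, ?_⟩⟩⟩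
  · have h₁ : MatrixSmoothOn (fun p : (ℝ × ℝ) × ℂ => dressedN E α N p.1.1 p.1.2)
        (dressedDomain U E α N ×ˢ {z : ℂ | max R ‖α‖ < ‖z‖}) :=
      (hE.smooth_dressedN hU).comp (φ := Prod.fst) contDiff_fst fun p hp => hp.1
    have h₂ : ContDiffOn ℝ ∞ (fun p : (ℝ × ℝ) × ℂ => 1 / (p.2 - α))
        (dressedDomain U E α N ×ˢ {z : ℂ | max R ‖α‖ < ‖z‖}) := by
      simp only [one_div]
      exact ContDiffOn.inv (ContDiff.contDiffOn (by fun_prop))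
        fun p hp => sub_ne_zero.2 (hne hp.2)
    exact ((hsm.mono (prod_mono (fun p hp => hp.1) fun z hz => hlt hz)).mul
      ((MatrixSmoothOn.const 1).sub (MatrixSmoothOn.smul h₂ h₁))).congr
      fun p hp => by beta_reduce; rw [hinv hp.1]
  · intro i k
    simp only [hinv h, Matrix.mul_apply, Matrix.sub_apply, Matrix.smul_apply, smul_eq_mul]
    refine DifferentiableOn.fun_sum fun l _ => DifferentiableOn.mul
      (((hR x t h.1).1 i l).mono fun z hz => hlt hz) (DifferentiableOn.sub (by fun_prop) ?_)
    exact (DifferentiableOn.div (by fun_prop) (by fun_prop)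
      fun z hz => sub_ne_zero.2 (hne hz)).mul_const _
  · simp only [hinv h]
    simpa using (hR x t h.1).2.1.mul (tendsto_one_sub_smul (dressedN E α N x t) α)
  · exact ((hR x t h.1).2.2 z (hlt hz)).1.mul (isUnit_nonsing_inv_iff.2
      (isUnit_nilpotentLoop (hE.dressedN_mul_self hN h) α z))
  · have hu := (isUnit_iff_isUnit_det _).1 (isUnit_nilpotentLoop hN α z)
    beta_reduce
    rw [hE.dressedFrame_eq_nilpotentLoop hN h (hne hz), hE.dressedN_zero h₀, Matrix.mul_inv_rev,
      nonsing_inv_nonsing_inv _ hu, ((hR x t h.1).2.2 z (hlt hz)).2]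
    simp only [mul_assoc]

end Main

theorem mainTheorem5 {n : ℕ} (a b : Matrix (Fin n) (Fin n) ℂ)
    (ha : a.IsDiag) (ha_ne : a ≠ 0) (ha_tr : a.trace = 0)
    (hb_tr : b.trace = 0) (hab : ⁅a, b⁆ = 0)
    (j : ℕ) (hj : 0 < j)
    (U : Set (ℝ × ℝ)) (u : ℝ → ℝ → Matrix (Fin n) (Fin n) ℂ)
    (Q : ℕ → ℝ → ℝ → Matrix (Fin n) (Fin n) ℂ)
    (E w : ℝ → ℝ → ℂ → Matrix (Fin n) (Fin n) ℂ)
    (hu : IsLocalFlowSolution a b j U u Q)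
    (hE : IsTrivialization a b j U u Q E)
    (hw : IsLocalReducedWaveFunction a b j U E w)
    (α : ℂ) (N : Matrix (Fin n) (Fin n) ℂ) (hN : N ^ 2 = 0) :
    ∃ (Q' : ℕ → ℝ → ℝ → Matrix (Fin n) (Fin n) ℂ)
      (E' : ℝ → ℝ → ℂ → Matrix (Fin n) (Fin n) ℂ),
      IsLocalFlowSolution a b j (dressedDomain U E α N)
        (fun x t => u x t - ⁅a, dressedN E α N x t⁆) Q' ∧
      IsTrivialization a b j (dressedDomain U E α N)
        (fun x t => u x t - ⁅a, dressedN E α N x t⁆) Q' E' ∧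
      (∀ x t, (x, t) ∈ dressedDomain U E α N → ∀ z : ℂ, z ≠ α →
        E' x t z = nilpotentLoop α 1 N z * E x t z *
          (nilpotentLoop α 1 (dressedN E α N x t) z)⁻¹) ∧
      IsLocalReducedWaveFunction a b j (dressedDomain U E α N) E'
        (fun x t z => w x t z * (nilpotentLoop α 1 (dressedN E α N x t) z)⁻¹) := by
  have hNN : N * N = 0 := by rw [← pow_two, hN]
  have hT := hE.dressed (α := α) hu.isOpen hu.family.zero_eq hNN
  have hF := hu.family.dressed (α := α) hu.isOpen hE hab hNN
  have hV := hE.isOpen_dressedDomain hu.isOpen (α := α) (N := N)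
  have hsm : MatrixSmoothOn (fun p : ℝ × ℝ => u p.1 p.2 - ⁅a, dressedN E α N p.1 p.2⁆)
      (dressedDomain U E α N) := by
    have h₁ := hE.smooth_dressedN hu.isOpen (α := α) (N := N)
    simp only [Ring.lie_def]
    exact (hu.smooth.mono fun p hp => hp.1).sub
      (((MatrixSmoothOn.const a).mul h₁).sub (h₁.mul (MatrixSmoothOn.const a)))
  -- The witnesses, determined by `hT`, are `dressedSeq` and `dressedFrame` formed with `Ñ`.
  exact ⟨_, _,
    { isOpen := hV
      zero_mem := hE.zero_mem_dressedDomain hu.zero_mem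
      smooth := hsm
      perp := fun x t h => (hu.perp x t h.1).sub_lie _
      family := hF
      flow := fun x t h => hT.flow_eq hV hsm (hF.smooth j) hF.zero_eq h },
    hT, fun x t h z hz => hE.dressedFrame_eq_nilpotentLoop hNN h hz,
    hw.dressed hE hu.isOpen hu.zero_mem hNN⟩
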